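/- Let $(W,S)$ be a Coxeter system with $W$ finite and length function $\ell$, and let $L\colon W\to\mathbb{Z}$ be a weight function, i.e. $L(ww')=L(w)+L(w')$ whenever $\ell(ww')=\ell(w)+\ell(w')$, with $L(s)>0$ for all $s\in S$. Let $A=\mathbb{Z}[v,v^{-1}]$, $v_s=v^{L(s)}$, and let $H$ be the Iwahori–Hecke algebra over $A$ with $A$-basis $\{T_w\}_{w\in W}$ and multiplication $T_sT_w=T_{sw}$ if $\ell(sw)>\ell(w)$, $T_sT_w=T_{sw}+(v_s-v_s^{-1})T_w$ if $\ell(sw)<\ell(w)$ ($s\in S$). Let $\{c_w\}_{w\in W}$ be the Kazhdan–Lusztig basis: $c_w$ is the unique element of $T_w+\sum_y v^{-1}\mathbb{Z}[v^{-1}]T_y$ fixed by the ring involution $v\mapsto v^{-1}$, $T_w\mapsto T_{w^{-1}}^{-1}$. Write $c_xc_y=\sum_z h_{x,y,z}c_z$, and let $h\mapsto h^\dagger$ be the $A$-algebra involution of $H$ with $T_s^\dagger=-T_s^{-1}$ for $s\in S$. Let $\leq_{\mathcal L}$ be the preorder on $W$ generated by the relations $y\leq_{\mathcal L}w$ whenever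 $h_{s,w,y}\neq0$ for some $s\in S$; the classes of the associated equivalence relation are the left cells of $W$ (with respect to $L$). For a left cell $\Gamma$, the free $A$-module with basis $\{c_y^\dagger\mid y\in\Gamma\}$ is an $H$-module via $c_x^\dagger\cdot c_y^\dagger=\sum_{z\in\Gamma}h_{x,y,z}c_z^\dagger$ ($x\in W$, $y\in\Gamma$); specialising $v\mapsto1$ (so that $T_w\mapsto w$) gives a $\mathbb{C}[W]$-module $[\Gamma]$. Let $I\subseteq S$, let $W_I=\langle I\rangle$, and apply the same definitions to $(W_I,I)$ and the weight function $L|_{W_I}$. Let $\Gamma'$ be a left cell of $W_I$. Then there exist pairwise different left cells $\Gamma_1,\ldots,\Gamma_r$ of $W$ such that $$\operatorname{Ind}_{W_I}^{W}([\Gamma'])\;\cong\;[\Gamma_1]\oplus\cdots\oplus[\Gamma_r]$$ as $\mathbb{C}[W]$-modules. -/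

import Mathlib

open scoped LaurentPolynomial MonoidAlgebra

/-!
Iwahori–Hecke algebras with unequal parameters, the Kazhdan–Lusztig basis, left cells and left cell
representations. All definitions take a group `G`, a set `S` of generators and a function
`L : G → ℤ`; they are meant for a finite Coxeter system `(G, S)` with a positive weight function `L`,
so that they apply both to `(W, S)` and to a parabolic subgroup `(W_I, I)`.
-/

noncomputable section

namespace KLCells

variable {G : Type*} [Group G]

/-- `A = ℤ[v, v⁻¹]`; the element `v ^ n` is `LaurentPolynomial.T n`. -/
abbrev LaurentA : Type := ℤ[T;T⁻¹]

/-- The length `ℓ(w)`: the least length of a word in the letters `S` whose product is `w`. -/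
def len (S : Set G) (w : G) : ℕ :=
  sInf {n | ∃ l : List G, (∀ s ∈ l, s ∈ S) ∧ l.prod = w ∧ l.length = n}

/-- For a Coxeter system, `len` is Mathlib's length function. -/
theorem len_range_simple {B W : Type*} [Group W] {M : CoxeterMatrix B} (cs : CoxeterSystem M W)
    (w : W) : len (Set.range cs.simple) w = cs.length w := by
  apply le_antisymm
  · obtain ⟨ω, hω, rfl⟩ := cs.exists_isReduced w
    refine Nat.sInf_le ⟨ω.map cs.simple, ?_, rfl, ?_⟩
    · intro s hs
      obtain ⟨i, -, rfl⟩ := List.mem_map.1 hs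
      exact ⟨i, rfl⟩
    · rw [List.length_map]; exact hω.symm
  · refine le_csInf ?_ ?_
    · obtain ⟨ω, hω, rfl⟩ := cs.exists_isReduced w
      refine ⟨_, ω.map cs.simple, ?_, rfl, rfl⟩
      intro s hs
      obtain ⟨i, -, rfl⟩ := List.mem_map.1 hs
      exact ⟨i, rfl⟩
    · rintro n ⟨l, hl, rfl, rfl⟩
      obtain ⟨ω, rfl⟩ : ∃ ω : List B, ω.map cs.simple = l := by
        induction l with
        | nil => exact ⟨[], rfl⟩
        | cons a t ih =>
          obtain ⟨ω, rfl⟩ := ih (fun s hs => hl s (List.mem_cons_of_mem _ hs))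
          obtain ⟨i, rfl⟩ := hl a List.mem_cons_self
          exact ⟨i :: ω, rfl⟩
      rw [List.length_map]
      exact cs.length_wordProd_le ω

/-- A weight function on `(G, S)`, positive on the generators. -/
structure IsPositiveWeight (S : Set G) (L : G → ℤ) : Prop where
  map_mul : ∀ w w' : G, len S (w * w') = len S w + len S w' → L (w * w') = L w + L w'
  pos : ∀ s ∈ S, 0 < L s

/-! ### The generic Iwahori–Hecke algebra -/

/-- The underlying module of the Iwahori–Hecke algebra `H`: the free `A`-module with basis `T_w`,
`w ∈ G`. -/
abbrev Hecke (G : Type*) : Type _ := G →₀ LaurentA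

/-- The basis element `T_w`. -/
abbrev stdBasis (w : G) : Hecke G := Finsupp.single w 1

/-- Left multiplication by `T_s` for a generator `s`:
`T_s T_w = T_{sw}` if `ℓ(sw) > ℓ(w)` and
`T_s T_w = T_{sw} + (v_s - v_s⁻¹) T_w` if `ℓ(sw) < ℓ(w)`, where `v_s = v ^ L(s)`. -/
def genMul (S : Set G) (L : G → ℤ) (s : G) : Module.End LaurentA (Hecke G) :=
  Finsupp.linearCombination LaurentA fun w =>
    if len S w < len S (s * w) then stdBasis (s * w)
    else stdBasis (s * w)
      + (LaurentPolynomial.T (L s) - LaurentPolynomial.T (-L s) : LaurentA) • stdBasis w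

/-- A reduced expression of `w` (a word in `S` of minimal length with product `w`). -/
def reducedWord (S : Set G) (w : G) : List G :=
  Classical.epsilon fun l : List G => (∀ s ∈ l, s ∈ S) ∧ l.prod = w ∧ l.length = len S w

/-- The multiplication of `H`, as the map sending `h` to left multiplication by `h`. It is linear in
`h`, and left multiplication by `T_x` is the product of the left multiplications by
`T_{s₁}, …, T_{s_k}` for a reduced expression `x = s₁ ⋯ s_k`. -/
def heckeMul (S : Set G) (L : G → ℤ) : Hecke G →ₗ[LaurentA] Module.End LaurentA (Hecke G) :=
  Finsupp.linearCombination LaurentA fun x => ((reducedWord S x).map (genMul S L)).prod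

/-- The element `T_{w⁻¹}⁻¹` of `H`: apply to `T_1 = 1` the inverse of left multiplication by
`T_{w⁻¹}`. -/
def invStd (S : Set G) (L : G → ℤ) (w : G) : Hecke G :=
  Ring.inverse (heckeMul S L (stdBasis w⁻¹)) (stdBasis 1)

/-- The bar involution of `H`: the ring automorphism with `v ↦ v⁻¹` and `T_w ↦ T_{w⁻¹}⁻¹`. -/
def bar (S : Set G) (L : G → ℤ) (h : Hecke G) : Hecke G :=
  h.sum fun w a => LaurentPolynomial.invert a • invStd S L w

/-- The involution `h ↦ h†` of `H`: the `A`-algebra automorphism with `T_s† = -T_s⁻¹`,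
that is, `T_w† = (-1)^{ℓ(w)} T_{w⁻¹}⁻¹`. -/
def dagger (S : Set G) (L : G → ℤ) : Hecke G →ₗ[LaurentA] Hecke G :=
  Finsupp.linearCombination LaurentA fun w => (-1 : LaurentA) ^ len S w • invStd S L w

/-! ### The Kazhdan–Lusztig basis and left cells -/

/-- `c` is a bar-invariant element of `T_w + ∑_y v⁻¹ℤ[v⁻¹] T_y`. -/
def IsKLElement (S : Set G) (L : G → ℤ) (w : G) (c : Hecke G) : Prop :=
  bar S L c = c ∧ ∀ (y : G) (n : ℤ), ((c - stdBasis w) y).coeff n ≠ 0 → n < 0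

/-- The Kazhdan–Lusztig ("new") basis element `c_w`: the unique bar-invariant element of
`T_w + ∑_y v⁻¹ℤ[v⁻¹] T_y`. -/
def klBasis (S : Set G) (L : G → ℤ) (w : G) : Hecke G :=
  Classical.epsilon (IsKLElement S L w)

/-- The coordinates of `h ∈ H` in the basis `c_w`: the family `(a_z)` with `h = ∑_z a_z c_z`. -/
def klCoord (S : Set G) (L : G → ℤ) (h : Hecke G) : G →₀ LaurentA :=
  Function.invFun (Finsupp.linearCombination LaurentA (klBasis S L)) h

/-- The structure constants: `c_x c_y = ∑_z h_{x,y,z} c_z`; the value is `z ↦ h_{x,y,z}`. -/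
def klStruct (S : Set G) (L : G → ℤ) (x y : G) : G →₀ LaurentA :=
  klCoord S L (heckeMul S L (klBasis S L x) (klBasis S L y))

/-- The left preorder: `y ≤_L w` is the reflexive and transitive closure of
"`h_{s,w,y} ≠ 0` for some `s ∈ S`". -/
def LeftLE (S : Set G) (L : G → ℤ) (y w : G) : Prop :=
  Relation.ReflTransGen (fun a b => ∃ s ∈ S, klStruct S L s b a ≠ 0) y w

/-- Left cells: the equivalence classes of `y ∼_L w ↔ y ≤_L w ∧ w ≤_L y`. -/
def IsLeftCell (S : Set G) (L : G → ℤ) (Γ : Set G) : Prop :=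
  ∃ w : G, Γ = {y | LeftLE S L y w ∧ LeftLE S L w y}

/-! ### Left cell representations -/

/-- The specialisation `v ↦ 1` of Laurent polynomials. -/
def specOne : LaurentA →+* ℂ := LaurentPolynomial.eval₂ (Int.castRingHom ℂ) (1 : ℂˣ)

/-- The specialisation `v ↦ 1` from `H` to the group algebra `ℂ[G]`, `T_w ↦ w`. -/
def specHecke (h : Hecke G) : ℂ[G] :=
  MonoidAlgebra.ofCoeff (h.mapRange specOne (map_zero specOne))

/-- `ρ` is the left cell representation `[Γ]`: the underlying space has basis `e_y`, `y ∈ Γ`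
(`e_y` stands for `c_y†`), and the action is obtained by `v ↦ 1` from
`c_x† · e_y = ∑_{z ∈ Γ} h_{x,y,z} e_z` for `x ∈ G`, `y ∈ Γ`. -/
def IsLeftCellRep (S : Set G) (L : G → ℤ) (Γ : Set G) (ρ : Representation ℂ G (Γ →₀ ℂ)) : Prop :=
  ∀ (x : G) (y : Γ),
    ρ.asAlgebraHom (specHecke (dagger S L (klBasis S L x))) (Finsupp.single y 1) =
      ((klStruct S L x y).subtypeDomain (· ∈ Γ)).mapRange specOne (map_zero specOne)

end KLCells

end

/-!
The argument is Geck's induction theorem for Kazhdan–Lusztig left cells.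

*Setting.* Everything is done for a set `S` of involutions with a sign character and the exchange
condition (`IsExchangeSystem`), because both `(W, S)` and `(W_I, I)` satisfy it; for Coxeter systems
the exchange condition comes from the action of `W` on signed group elements (`signedConj`). Left
multiplications by the `T_s` commute with right multiplications, so left multiplication by `T_w`
does not depend on a reduced expression (`heckeMul_std_prod`), and the bar map is an involution that
is unitriangular with respect to the length. The Kazhdan–Lusztig lemma (`exists_bar_invariant`),
stated for an arbitrary basis with a unitriangular semilinear involution, gives the basis `c_w`.

*Relative basis.* Let `X` be the set of minimal representatives of the cosets `x W_I`. The elements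
`T_x c_u` with `x ∈ X`, `u ∈ W_I` form a basis of `H`. By Deodhar's lemma (`gen_mul_minRep`), the
bar involution maps `T_x c_u` to itself plus a combination of the `T_y c_v` with `ℓ(y) < ℓ(x)` and
`v ≤ u` in the left preorder of `W_I`. Applying the same lemma to this basis, uniqueness shows that
`c_{xu}` is `T_x c_u` plus a combination of such `T_y c_v` (`klBasis_sub_relFamily_mem`). For fixed
`u`, the span of the `c_{xv}` with `x ∈ X` and `v ≤ u` is therefore a left ideal, so `xu ↦ u` is
monotone for the left preorders (`leftLE_parabolicPart`), and the preimage `X Γ'` of a left cell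
`Γ'` is a union of left cells.

*Specialisation.* At `v = 1` the group algebra has the basis `c_w`, in which the regular
representation is triangular for the left preorder. Convex sets give subquotients, and the twist by
the sign character accounts for `†`. The `W_I`-equivariant map `e_u ↦ e_u` induces a homomorphism
`Ind [Γ'] → [X Γ']`, which is surjective by the expansion of `c_{xu}` and injective since
`Ind [Γ']` is spanned by the `x ⊗ e_u` (`nonempty_ind_equiv_preimageRep`). Finally `[X Γ']` is the
direct sum of the left cell representations it contains, by averaging over `W` as in Maschke's
theorem (`nonempty_equiv_directSum`).
-/

noncomputable section

namespace KLCells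

variable {G : Type*} [Group G]

/-! ### Groups generated by involutions with the exchange property -/

/-- `S` is a set of involutions generating `G`, all of sign `-1` under a character of `G`, such that
the exchange condition holds for arbitrary (not only reduced) words. This is the common abstraction
of a Coxeter system and of its parabolic subgroups. -/
structure IsExchangeSystem (S : Set G) : Prop where
  mul_self : ∀ s ∈ S, s * s = 1
  exists_word : ∀ w : G, ∃ l : List G, (∀ s ∈ l, s ∈ S) ∧ l.prod = w
  exists_sign : ∃ ε : G →* ℤˣ, ∀ s ∈ S, ε s = -1
  exchange : ∀ s ∈ S, ∀ l : List G, (∀ a ∈ l, a ∈ S) → len S (l.prod * s) < len S l.prod →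
    ∃ l' : List G, l'.Sublist l ∧ l'.length + 1 = l.length ∧ l.prod * s = l'.prod

section Length

variable {S : Set G}

theorem len_prod_le {l : List G} (hl : ∀ s ∈ l, s ∈ S) : len S l.prod ≤ l.length :=
  Nat.sInf_le ⟨l, hl, rfl, rfl⟩

theorem len_one : len S (1 : G) = 0 := by
  simpa using len_prod_le (S := S) (l := []) (by simp)

namespace IsExchangeSystem

variable (hS : IsExchangeSystem S)
include hS

theorem inv_eq {s : G} (hs : s ∈ S) : s⁻¹ = s :=
  inv_eq_of_mul_eq_one_left (hS.mul_self s hs)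

theorem mul_mul_cancel_left {s : G} (hs : s ∈ S) (w : G) : s * (s * w) = w := by
  rw [← mul_assoc, hS.mul_self s hs, one_mul]

theorem mul_mul_cancel_right {s : G} (hs : s ∈ S) (w : G) : w * s * s = w := by
  rw [mul_assoc, hS.mul_self s hs, mul_one]

theorem exists_reduced (w : G) :
    ∃ l : List G, (∀ s ∈ l, s ∈ S) ∧ l.prod = w ∧ l.length = len S w := by
  obtain ⟨l, hl, hw⟩ := hS.exists_word w
  exact Nat.sInf_mem (s := {n | ∃ l : List G, (∀ s ∈ l, s ∈ S) ∧ l.prod = w ∧ l.length = n})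
    ⟨_, l, hl, hw, rfl⟩

theorem reducedWord_spec (w : G) : (∀ s ∈ reducedWord S w, s ∈ S) ∧ (reducedWord S w).prod = w ∧
    (reducedWord S w).length = len S w :=
  Classical.epsilon_spec (hS.exists_reduced w)

theorem len_eq_zero {w : G} (h : len S w = 0) : w = 1 := by
  obtain ⟨l, -, rfl, hl⟩ := hS.exists_reduced w
  rw [h, List.length_eq_zero_iff] at hl
  simp [hl]

theorem len_mul_le (a b : G) : len S (a * b) ≤ len S a + len S b := by
  obtain ⟨l, hl, rfl, hl'⟩ := hS.exists_reduced a
  obtain ⟨m, hm, rfl, hm'⟩ := hS.exists_reduced b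
  rw [← hl', ← hm', ← List.prod_append, ← List.length_append]
  exact len_prod_le fun s hs => (List.mem_append.1 hs).elim (hl s) (hm s)

theorem prod_reverse {l : List G} (hl : ∀ s ∈ l, s ∈ S) : l.reverse.prod = l.prod⁻¹ := by
  rw [List.prod_inv_reverse]
  congr 2
  exact ((List.map_congr_left fun s hs => hS.inv_eq (hl s hs)).trans (List.map_id l)).symm

theorem len_inv_le (w : G) : len S w⁻¹ ≤ len S w := by
  obtain ⟨l, hl, rfl, hl'⟩ := hS.exists_reduced w
  rw [← hS.prod_reverse hl, ← hl', ← l.length_reverse]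
  exact len_prod_le fun s hs => hl s (List.mem_reverse.1 hs)

theorem len_inv (w : G) : len S w⁻¹ = len S w :=
  le_antisymm (hS.len_inv_le w) (by simpa using hS.len_inv_le w⁻¹)

theorem sign_eq {ε : G →* ℤˣ} (hε : ∀ s ∈ S, ε s = -1) (w : G) : ε w = (-1) ^ len S w := by
  obtain ⟨l, hl, rfl, hl'⟩ := hS.exists_reduced w
  rw [← hl', map_list_prod, ← List.length_map (f := ε)]
  refine List.prod_eq_pow_card _ _ fun x hx => ?_
  obtain ⟨s, hs, rfl⟩ := List.mem_map.1 hx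
  exact hε s (hl s hs)

theorem neg_one_pow_len_mul (a b : G) :
    (-1 : ℤˣ) ^ len S (a * b) = (-1) ^ len S a * (-1) ^ len S b := by
  obtain ⟨ε, hε⟩ := hS.exists_sign
  simp only [← hS.sign_eq hε, map_mul]

theorem len_gen {s : G} (hs : s ∈ S) : len S s = 1 := by
  have h1 : len S s ≤ 1 := by
    simpa using len_prod_le (S := S) (l := [s]) (by simpa using hs)
  obtain ⟨ε, hε⟩ := hS.exists_sign
  have h2 : len S s ≠ 0 := fun h => by
    have := hS.sign_eq hε s
    rw [hε s hs, h] at this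
    exact absurd this (by decide)
  omega

theorem len_gen_mul {s : G} (hs : s ∈ S) (w : G) :
    len S (s * w) = len S w + 1 ∨ len S (s * w) + 1 = len S w := by
  have h1 := hS.len_mul_le s w
  have h2 := hS.len_mul_le s (s * w)
  rw [hS.mul_mul_cancel_left hs] at h2
  rw [hS.len_gen hs] at h1 h2
  have h3 : len S (s * w) ≠ len S w := fun h => by
    have := hS.neg_one_pow_len_mul s w
    rw [h, hS.len_gen hs, pow_one] at this
    rcases neg_one_pow_eq_or ℤˣ (len S w) with h | h <;> rw [h] at this <;>
      exact absurd this (by decide)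
  omega

theorem len_mul_gen {s : G} (hs : s ∈ S) (w : G) :
    len S (w * s) = len S w + 1 ∨ len S (w * s) + 1 = len S w := by
  have := hS.len_gen_mul hs w⁻¹
  rwa [← hS.len_inv (s * w⁻¹), mul_inv_rev, inv_inv, hS.inv_eq hs, hS.len_inv] at this

/-- Induction on the length, multiplying by generators on the left. -/
theorem induction_left {p : G → Prop} (one : p 1)
    (mul : ∀ s ∈ S, ∀ w, len S (s * w) = len S w + 1 → p w → p (s * w)) (w : G) : p w := by
  obtain ⟨l, hl, rfl, hl'⟩ := hS.exists_reduced w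
  induction l with
  | nil => simpa using one
  | cons s l ih =>
    have hs : s ∈ S := hl s List.mem_cons_self
    have hl2 : ∀ a ∈ l, a ∈ S := fun a ha => hl a (List.mem_cons_of_mem _ ha)
    have h1 := len_prod_le hl2
    have h2 := hS.len_gen_mul hs l.prod
    rw [List.prod_cons, List.length_cons] at hl'
    rw [List.prod_cons]
    exact mul s hs _ (by omega) (ih hl2 (by omega))

/-- If `s` and `t` both lengthen or both shorten `w`, and `swt` has the length of `w`,
then `sw = wt`. -/
theorem gen_mul_eq_mul_gen {s t w : G} (hs : s ∈ S) (ht : t ∈ S)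
    (h1 : len S (s * w * t) = len S w) (h2 : len S (s * w) = len S (w * t)) : s * w = w * t := by
  have key : ∀ w : G, len S (s * w * t) = len S w → len S (s * w) = len S (w * t) →
      len S (s * w) = len S w + 1 → s * w = w * t := by
    intro w h1 h2 h3
    obtain ⟨l, hl, rfl, hl'⟩ := hS.exists_reduced w
    obtain ⟨l', hsub, hlen, hprod⟩ := hS.exchange t ht (s :: l)
      (by simpa using ⟨hs, hl⟩) (by rw [List.prod_cons]; omega)
    rw [List.prod_cons] at hprod
    rcases List.sublist_cons_iff.1 hsub with h | ⟨r, rfl, hr⟩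
    · rw [h.eq_of_length (by simpa using hlen)] at hprod
      rw [← hprod, hS.mul_mul_cancel_right ht, hprod]
    · rw [List.prod_cons, mul_assoc, mul_left_cancel_iff] at hprod
      have := len_prod_le (S := S) (l := r) fun a ha => hl a (hr.subset ha)
      rw [← hprod] at this
      simp only [List.length_cons] at hlen
      omega
  rcases hS.len_gen_mul hs w with h | h
  · exact key w h1 h2 h
  · have := key (s * w) (by rw [hS.mul_mul_cancel_left hs, ← h2])
      (by rw [hS.mul_mul_cancel_left hs, h1]) (by rw [hS.mul_mul_cancel_left hs, h])
    rw [hS.mul_mul_cancel_left hs] at this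
    nth_rw 2 [this]
    rw [hS.mul_mul_cancel_right ht]

end IsExchangeSystem

end Length

/-! ### Coxeter systems have the exchange property -/

section Coxeter

open Classical in
/-- The action of a simple reflection on pairs of a group element and a sign, which records
whether the element equals that reflection. The resulting action of the Coxeter group computes the
parity of the number of occurrences of an element in a right inversion sequence. -/
def signedConj {B W : Type*} [Group W] {M : CoxeterMatrix B} (cs : CoxeterSystem M W) (i : B) :
    Function.End (W × ZMod 2) :=
  fun p => (cs.simple i * p.1 * cs.simple i, p.2 + if p.1 = cs.simple i then 1 else 0)

variable {B W : Type*} [Group W] {M : CoxeterMatrix B} (cs : CoxeterSystem M W)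

open Classical in
theorem signedConj_mul_pow (i j : B) (k : ℕ) (p : W × ZMod 2) :
    ((signedConj cs i * signedConj cs j) ^ k) p =
      ((cs.simple i * cs.simple j) ^ k * p.1 * ((cs.simple i * cs.simple j) ^ k)⁻¹,
        p.2 + ∑ n ∈ Finset.range (2 * k),
          if p.1 = cs.simple j * (cs.simple i * cs.simple j) ^ n then 1 else 0) := by
  set r := cs.simple i * cs.simple j with hr
  have hinv : ∀ k : ℕ, (r ^ k)⁻¹ * cs.simple j = cs.simple j * r ^ k := by
    intro k
    induction k with
    | zero => simp
    | succ k ih =>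
      rw [pow_succ', mul_inv_rev, mul_assoc]
      have : r⁻¹ * cs.simple j = cs.simple j * r := by simp [hr, mul_assoc]
      rw [this, ← mul_assoc, ih, mul_assoc, ← pow_succ, pow_succ']
  induction k with
  | zero => simp; rfl
  | succ k ih =>
    have e : ∀ q : W × ZMod 2, (signedConj cs i * signedConj cs j) q =
      (r * q.1 * r⁻¹, q.2 + ((if q.1 = cs.simple j then 1 else 0) +
        if q.1 = cs.simple j * r then 1 else 0)) := by
      intro q
      show signedConj cs i (signedConj cs j q) = _
      have : cs.simple j * q.1 * cs.simple j = cs.simple i ↔ q.1 = cs.simple j * r := by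
        constructor
        · intro h; rw [hr, ← h]; simp [mul_assoc]
        · intro h; rw [h, hr]; simp [mul_assoc]
      simp only [signedConj, this]
      simp [hr, mul_assoc, add_assoc]
    rw [pow_succ']
    show (signedConj cs i * signedConj cs j) (((signedConj cs i * signedConj cs j) ^ k) p) = _
    rw [ih, e]
    refine Prod.ext ?_ ?_
    · simp only [pow_succ', mul_inv_rev, mul_assoc]
    · have h1 : r ^ k * p.1 * (r ^ k)⁻¹ = cs.simple j ↔ p.1 = cs.simple j * r ^ (2 * k) := by
        rw [mul_inv_eq_iff_eq_mul, ← eq_inv_mul_iff_mul_eq, ← mul_assoc, hinv, mul_assoc,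
          ← pow_add, two_mul]
      have h2 : r ^ k * p.1 * (r ^ k)⁻¹ = cs.simple j * r ↔
          p.1 = cs.simple j * r ^ (2 * k + 1) := by
        rw [mul_inv_eq_iff_eq_mul, ← eq_inv_mul_iff_mul_eq, ← mul_assoc, ← mul_assoc, hinv,
          mul_assoc, mul_assoc, ← pow_succ', ← pow_add, two_mul, add_assoc]
      simp only [h1, h2]
      rw [show 2 * (k + 1) = 2 * k + 1 + 1 by ring, Finset.sum_range_succ, Finset.sum_range_succ]
      ring

theorem isLiftable_signedConj : M.IsLiftable (signedConj cs) := by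
  classical
  intro i j
  funext p
  rw [signedConj_mul_pow, cs.simple_mul_simple_pow]
  -- The summands have period `M i j`, so each value is counted twice.
  have : ∑ n ∈ Finset.range (2 * M i j),
      (if p.1 = cs.simple j * (cs.simple i * cs.simple j) ^ n then (1 : ZMod 2) else 0) = 0 := by
    rw [two_mul, Finset.sum_range_add]
    simp only [pow_add, cs.simple_mul_simple_pow, one_mul]
    exact CharTwo.add_self_eq_zero _
  rw [this]
  simp
  rfl

open Classical in
theorem lift_signedConj_wordProd (ω : List B) (t : W) :
    cs.lift ⟨_, isLiftable_signedConj cs⟩ (cs.wordProd ω) (t, 0) =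
      (cs.wordProd ω * t * (cs.wordProd ω)⁻¹, ((cs.rightInvSeq ω).count t : ZMod 2)) := by
  induction ω with
  | nil => simp; rfl
  | cons i ω ih =>
    rw [cs.wordProd_cons, map_mul]
    show cs.lift ⟨_, isLiftable_signedConj cs⟩ (cs.simple i)
      (cs.lift ⟨_, isLiftable_signedConj cs⟩ (cs.wordProd ω) (t, 0)) = _
    rw [ih, cs.lift_apply_simple]
    refine Prod.ext ?_ ?_
    · simp [signedConj, mul_assoc]
    · have : cs.wordProd ω * t * (cs.wordProd ω)⁻¹ = cs.simple i ↔
          (cs.wordProd ω)⁻¹ * cs.simple i * cs.wordProd ω = t := by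
        rw [mul_inv_eq_iff_eq_mul, ← eq_inv_mul_iff_mul_eq, ← mul_assoc, eq_comm]
      simp only [signedConj, this, CoxeterSystem.rightInvSeq, List.count_cons, beq_iff_eq]
      push_cast
      rfl

/-- The strong exchange condition for a simple reflection: a right descent of `π(ω)` occurs in the
right inversion sequence of `ω`. The parity of its number of occurrences depends on `π(ω)` only, and
it is odd for a reduced word ending in the descent. -/
theorem mem_rightInvSeq_of_length_lt {ω : List B} {i : B}
    (h : cs.length (cs.wordProd ω * cs.simple i) < cs.length (cs.wordProd ω)) :
    cs.simple i ∈ cs.rightInvSeq ω := by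
  classical
  obtain ⟨ω', hω', he⟩ := cs.exists_isReduced (cs.wordProd ω * cs.simple i)
  have hw : cs.wordProd (ω' ++ [i]) = cs.wordProd ω := by
    rw [cs.wordProd_append, ← he]; simp
  have hred : cs.IsReduced (ω' ++ [i]) := by
    have h1 := cs.length_mul_simple (cs.wordProd ω) i
    rw [CoxeterSystem.IsReduced, hw, List.length_append, List.length_singleton, ← hω'.eq, ← he]
    omega
  have hmem : cs.simple i ∈ cs.rightInvSeq (ω' ++ [i]) := by
    have := cs.rightInvSeq_concat ω' i
    rw [List.concat_eq_append] at this
    rw [this]; simp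
  have h1 := List.count_eq_one_of_mem hred.nodup_rightInvSeq hmem
  have h2 := congrArg Prod.snd (lift_signedConj_wordProd cs (ω' ++ [i]) (cs.simple i))
  rw [hw, lift_signedConj_wordProd, h1] at h2
  by_contra h3
  rw [List.count_eq_zero_of_not_mem h3] at h2
  simp at h2

theorem isExchangeSystem_range_simple : IsExchangeSystem (Set.range cs.simple) where
  mul_self := by rintro _ ⟨i, rfl⟩; exact cs.simple_mul_simple_self i
  exists_word w := by
    obtain ⟨ω, rfl⟩ := cs.wordProd_surjective w
    refine ⟨ω.map cs.simple, fun s hs => ?_, rfl⟩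
    obtain ⟨i, -, rfl⟩ := List.mem_map.1 hs
    exact ⟨i, rfl⟩
  exists_sign := by
    refine ⟨cs.lift ⟨fun _ => -1, fun i j => by simp⟩, ?_⟩
    rintro _ ⟨i, rfl⟩
    exact cs.lift_apply_simple _ i
  exchange := by
    rintro _ ⟨i, rfl⟩ l hl hlt
    obtain ⟨ω, rfl⟩ : l ∈ Set.range (List.map cs.simple) := by
      rw [Set.range_list_map]; exact hl
    rw [len_range_simple, len_range_simple] at hlt
    obtain ⟨j, hj, hji⟩ := List.mem_iff_getElem.1 (mem_rightInvSeq_of_length_lt cs hlt)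
    have hj' : j < ω.length := by simpa using hj
    refine ⟨(ω.eraseIdx j).map cs.simple, (List.eraseIdx_sublist _ _).map _, ?_, ?_⟩
    · simp only [List.length_map, List.length_eraseIdx, if_pos hj']; omega
    · have := cs.wordProd_mul_getD_rightInvSeq ω j
      rwa [List.getD_eq_getElem _ _ hj, hji] at this

end Coxeter

/-! ### Parabolic subgroups and minimal coset representatives -/

/-- The generators `I`, as a subset of the parabolic subgroup they generate. -/
abbrev parabolicGens (I : Set G) : Set (Subgroup.closure I) := {s | (s : G) ∈ I}

/-- The representatives of minimal length of the left cosets of the subgroup generated by `I`. -/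
def minReps (S I : Set G) : Set G :=
  {x | ∀ u : Subgroup.closure I, len S x ≤ len S (x * u)}

section Parabolic

variable {S I : Set G} (hS : IsExchangeSystem S) (hI : I ⊆ S)
include hS

omit hS in
theorem exists_mul_minRep (w : G) :
    ∃ x ∈ minReps S I, ∃ u : Subgroup.closure I, x * u = w := by
  have hne : (Set.range fun u : Subgroup.closure I => w * u).Nonempty := Set.range_nonempty _
  obtain ⟨u, hu⟩ := Function.argminOn_mem (len S) _ hne
  refine ⟨w * u, fun u' => ?_, u⁻¹, by simp⟩
  have := Function.argminOn_le (len S) (Set.range fun u : Subgroup.closure I => w * u)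
    (a := w * u * u') ⟨u * u', by simp [mul_assoc]⟩
  rwa [← hu] at this

omit hS in
theorem exists_map_coe_eq {l : List G} (hl : ∀ s ∈ l, s ∈ I) : ∃ m : List (Subgroup.closure I),
    (∀ s ∈ m, s ∈ parabolicGens I) ∧ m.map Subtype.val = l := by
  induction l with
  | nil => exact ⟨[], by simp, rfl⟩
  | cons a l ih =>
    obtain ⟨m, hm, rfl⟩ := ih fun s hs => hl s (List.mem_cons_of_mem _ hs)
    have ha : a ∈ I := hl a List.mem_cons_self
    refine ⟨⟨a, Subgroup.subset_closure ha⟩ :: m, ?_, rfl⟩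
    intro s hs
    rcases List.mem_cons.1 hs with rfl | hs
    · exact ha
    · exact hm s hs

omit hS in
theorem one_mem_minReps : (1 : G) ∈ minReps S I := fun u => by simp [len_one]

include hI

/-- An element of a parabolic subgroup has a word in `I` that is reduced in the whole group, by the
exchange condition for words in `I`. -/
theorem exists_reduced_parabolic (w : Subgroup.closure I) :
    ∃ l : List G, (∀ s ∈ l, s ∈ I) ∧ l.prod = w ∧ l.length = len S (w : G) := by
  obtain ⟨w, hw⟩ := w
  have key : ∀ x : G, ∀ s ∈ I,
      (∃ l : List G, (∀ s ∈ l, s ∈ I) ∧ l.prod = x ∧ l.length = len S x) →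
      ∃ l : List G, (∀ s ∈ l, s ∈ I) ∧ l.prod = x * s ∧ l.length = len S (x * s) := by
    rintro _ s hs ⟨l, hl, rfl, hlen⟩
    rcases hS.len_mul_gen (hI hs) l.prod with h | h
    · refine ⟨l ++ [s], ?_, by simp, by rw [h, ← hlen]; simp⟩
      intro a ha
      rcases List.mem_append.1 ha with h | h
      · exact hl a h
      · rwa [List.mem_singleton.1 h]
    · obtain ⟨l', hsub, hlen', hprod⟩ := hS.exchange s (hI hs) l (fun a ha => hI (hl a ha))
        (by omega)
      exact ⟨l', fun a ha => hl a (hsub.subset ha), hprod.symm, by omega⟩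
  show ∃ l : List G, (∀ s ∈ l, s ∈ I) ∧ l.prod = w ∧ l.length = len S w
  induction hw using Subgroup.closure_induction_right with
  | one => exact ⟨[], by simp, rfl, by simp [len_one]⟩
  | mul_right x hx s hs ih => exact key x s hs ih
  | mul_inv_cancel x hx s hs ih => rw [hS.inv_eq (hI hs)]; exact key x s hs ih

theorem len_parabolic (w : Subgroup.closure I) : len (parabolicGens I) w = len S (w : G) := by
  obtain ⟨l, hl, hw, hlen⟩ := exists_reduced_parabolic hS hI w
  obtain ⟨m, hm, rfl⟩ := exists_map_coe_eq hl
  have hmw : m.prod = w := Subtype.ext (by rw [Subgroup.val_list_prod, hw])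
  rw [← hlen, List.length_map]
  apply le_antisymm
  · rw [← hmw]
    exact len_prod_le hm
  · refine le_csInf ⟨_, m, hm, hmw, rfl⟩ ?_
    · rintro _ ⟨l, hl, rfl, rfl⟩
      rw [← m.length_map (f := Subtype.val), hlen, Subgroup.val_list_prod,
        ← l.length_map (f := Subtype.val)]
      refine len_prod_le fun s hs => ?_
      obtain ⟨a, ha, rfl⟩ := List.mem_map.1 hs
      exact hI (hl a ha)

theorem isExchangeSystem_parabolicGens : IsExchangeSystem (parabolicGens I) where
  mul_self s hs := Subtype.ext (hS.mul_self _ (hI hs))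
  exists_word w := by
    obtain ⟨l, hl, hw, -⟩ := exists_reduced_parabolic hS hI w
    obtain ⟨m, hm, rfl⟩ := exists_map_coe_eq hl
    exact ⟨m, hm, Subtype.ext (by rw [Subgroup.val_list_prod, hw])⟩
  exists_sign := by
    obtain ⟨ε, hε⟩ := hS.exists_sign
    exact ⟨ε.comp (Subgroup.closure I).subtype, fun s hs => hε _ (hI hs)⟩
  exchange := by
    intro s hs l hl hlt
    rw [len_parabolic hS hI, len_parabolic hS hI, Subgroup.coe_mul, Subgroup.val_list_prod] at hlt
    obtain ⟨l', hsub, hlen, hprod⟩ := hS.exchange s (hI hs) (l.map (↑)) (by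
      intro a ha
      obtain ⟨b, hb, rfl⟩ := List.mem_map.1 ha
      exact hI (hl b hb)) hlt
    obtain ⟨m, hm, rfl⟩ := List.sublist_map_iff.1 hsub
    refine ⟨m, hm, by simpa using hlen, Subtype.ext ?_⟩
    rw [Subgroup.coe_mul, Subgroup.val_list_prod, Subgroup.val_list_prod, hprod]

theorem isPositiveWeight_parabolicGens {L : G → ℤ} (hL : IsPositiveWeight S L) :
    IsPositiveWeight (parabolicGens I) (fun w => L w) where
  map_mul w w' h := by
    simp only [len_parabolic hS hI] at h
    exact hL.map_mul w w' h
  pos s hs := hL.pos s (hI hs)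

/-- Lengths add up in `x * u` for `x` of minimal length in its coset. -/
theorem len_minRep_mul {x : G} (hx : x ∈ minReps S I) (u : Subgroup.closure I) :
    len S (x * u) = len S x + len S (u : G) := by
  obtain ⟨l, hl, hu, hlen⟩ := exists_reduced_parabolic hS hI u
  obtain ⟨u, hu'⟩ := u
  dsimp only at *
  subst hu
  clear hu'
  rw [← hlen]
  induction l using List.reverseRecOn with
  | nil => simp
  | append_singleton l t ih =>
    have ht : t ∈ I := hl t (by simp)
    have hl' : ∀ s ∈ l, s ∈ I := fun s hs => hl s (by simp [hs])
    have hlS : ∀ s ∈ l, s ∈ S := fun s hs => hI (hl' s hs)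
    have hmem : ∀ l : List G, (∀ s ∈ l, s ∈ I) → l.prod ∈ Subgroup.closure I := fun l h =>
      Subgroup.list_prod_mem _ fun s hs => Subgroup.subset_closure (h s hs)
    rw [List.length_append, List.length_singleton] at hlen ⊢
    have h1 := len_prod_le hlS
    have h2 := hS.len_mul_gen (hI ht) l.prod
    rw [List.prod_append, List.prod_singleton] at hlen ⊢
    specialize ih hl' (by omega)
    rw [← mul_assoc]
    rcases hS.len_mul_gen (hI ht) (x * l.prod) with h | h
    · omega
    · exfalso
      obtain ⟨a, haS, rfl, halen⟩ := hS.exists_reduced x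
      obtain ⟨b, hsub, hblen, hprod⟩ := hS.exchange t (hI ht) (a ++ l) (by
        intro s hs
        exact (List.mem_append.1 hs).elim (haS s) (hlS s)) (by rw [List.prod_append]; omega)
      obtain ⟨a', l', rfl, ha', hl2⟩ := List.sublist_append_iff.1 hsub
      simp only [List.length_append, List.prod_append] at hblen hprod
      have h3 := ha'.length_le
      have h4 := hl2.length_le
      rcases h3.lt_or_eq with h5 | h5
      · -- The letter is deleted from the word of `x`: the coset of `x` has a shorter element.
        obtain rfl := hl2.eq_of_length (by omega)
        have h6 := hx ⟨l'.prod * t * l'.prod⁻¹, mul_mem (mul_mem (hmem _ hl')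
          (Subgroup.subset_closure ht)) (inv_mem (hmem _ hl'))⟩
        have h7 : a.prod * (l'.prod * t * l'.prod⁻¹) = a'.prod := by
          rw [mul_assoc] at hprod
          rw [← mul_assoc, hprod]; simp
        rw [h7] at h6
        have h8 := len_prod_le (S := S) (l := a') fun s hs => haS s (ha'.subset hs)
        omega
      · -- The letter is deleted from the word of `u`, which is not reduced then.
        obtain rfl := ha'.eq_of_length h5
        rw [mul_assoc, mul_left_cancel_iff] at hprod
        have h8 := len_prod_le (S := S) (l := l') fun s hs => hlS s (hl2.subset hs)
        rw [← hprod] at h8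
        omega

theorem minRep_mul_inj {x x' : G} (hx : x ∈ minReps S I) (hx' : x' ∈ minReps S I)
    {u u' : Subgroup.closure I} (h : x * u = x' * u') : x = x' ∧ u = u' := by
  have e1 : x = x' * (u' * u⁻¹ : Subgroup.closure I) := by
    push_cast; rw [← mul_assoc, ← h]; simp
  have e2 : x' = x * (u * u'⁻¹ : Subgroup.closure I) := by
    push_cast; rw [← mul_assoc, h]; simp
  have h1 := len_minRep_mul hS hI hx' (u' * u⁻¹)
  have h2 := len_minRep_mul hS hI hx (u * u'⁻¹)
  rw [← e1] at h1
  rw [← e2] at h2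
  have h3 := hS.len_eq_zero (w := ((u * u'⁻¹ : Subgroup.closure I) : G)) (by omega)
  have h4 : u = u' := mul_inv_eq_one.1 (Subtype.ext h3)
  subst h4
  exact ⟨mul_right_cancel h, rfl⟩

/-- Every element of the group is uniquely `x * u` with `x` a minimal coset representative and `u`
in the parabolic subgroup. -/
def cosetDecomp : minReps S I × Subgroup.closure I ≃ G :=
  Equiv.ofBijective (fun p => (p.1 : G) * p.2) <| by
    constructor
    · rintro ⟨x, u⟩ ⟨x', u'⟩ h
      obtain ⟨h1, h2⟩ := minRep_mul_inj hS hI x.2 x'.2 h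
      exact Prod.ext (Subtype.ext h1) h2
    · intro w
      obtain ⟨x, hx, u, h⟩ := exists_mul_minRep (S := S) (I := I) w
      exact ⟨(⟨x, hx⟩, u), h⟩

@[simp] theorem cosetDecomp_apply (p : minReps S I × Subgroup.closure I) :
    cosetDecomp hS hI p = p.1 * p.2 := rfl

/-- Deodhar's lemma. -/
theorem gen_mul_minRep {s x : G} (hs : s ∈ S) (hx : x ∈ minReps S I) :
    s * x ∈ minReps S I ∨ ∃ t : Subgroup.closure I, (t : G) ∈ I ∧ s * x = x * t := by
  obtain ⟨x', hx', u, h⟩ := exists_mul_minRep (S := S) (I := I) (s * x)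
  by_cases hu : u = 1
  · left
    rw [hu] at h
    rw [← h]
    simpa using hx'
  right
  have hu0 : len S (u : G) ≠ 0 := fun h => hu (Subtype.ext (hS.len_eq_zero h))
  have h1 := len_minRep_mul hS hI hx' u
  have h2 := len_minRep_mul hS hI hx u⁻¹
  have h3 : x * (u⁻¹ : Subgroup.closure I) = s * x' := by
    push_cast
    rw [mul_inv_eq_iff_eq_mul, mul_assoc, h, hS.mul_mul_cancel_left hs]
  rw [h3] at h2
  rw [h] at h1
  have h4 := hS.len_gen_mul hs x
  have h5 := hS.len_gen_mul hs x'
  rw [Subgroup.coe_inv, hS.len_inv] at h2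
  have hu1 : len S (u : G) = 1 := by omega
  obtain ⟨l, hl, hlu, hlen⟩ := exists_reduced_parabolic hS hI u
  rw [hu1, List.length_eq_one_iff] at hlen
  obtain ⟨t, rfl⟩ := hlen
  have ht : t ∈ I := hl t (by simp)
  rw [List.prod_singleton] at hlu
  refine ⟨u, hlu ▸ ht, ?_⟩
  have h6 : s * x * u = x' := by rw [← h, ← hlu, hS.mul_mul_cancel_right (hI ht)]
  have h7 := len_minRep_mul hS hI hx u
  refine hS.gen_mul_eq_mul_gen hs (hlu ▸ hI ht) ?_ ?_
  · rw [h6]; omega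
  · omega

theorem minRep_of_gen_mul {s y : G} (hs : s ∈ S) (hsy : s * y ∈ minReps S I)
    (hlen : len S (s * y) = len S y + 1) : y ∈ minReps S I := by
  obtain ⟨x', hx', u, rfl⟩ := exists_mul_minRep (S := S) (I := I) y
  have h1 := len_minRep_mul hS hI hx' u
  have h2 := hsy u⁻¹
  have h3 := hS.len_gen_mul hs x'
  have e : s * (x' * u) * (u⁻¹ : Subgroup.closure I) = s * x' := by simp [mul_assoc]
  rw [e] at h2
  have h4 : u = 1 := Subtype.ext (hS.len_eq_zero (by omega))
  rw [h4]
  simpa using hx'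

end Parabolic

/-! ### The multiplication of the Hecke algebra -/

section HeckeAlgebra

variable {S : Set G} {L : G → ℤ}

/-- The coefficient `v_s - v_s⁻¹` of the quadratic relation. -/
def quadCoeff (L : G → ℤ) (s : G) : LaurentA :=
  LaurentPolynomial.T (L s) - LaurentPolynomial.T (-L s)

omit [Group G] in
@[simp] theorem invert_quadCoeff (s : G) :
    LaurentPolynomial.invert (quadCoeff L s) = -quadCoeff L s := by
  simp [quadCoeff]

/-- Left multiplication by `T_s⁻¹ = T_s - (v_s - v_s⁻¹)`. -/
def genInv (S : Set G) (L : G → ℤ) (s : G) : Module.End LaurentA (Hecke G) :=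
  genMul S L s - quadCoeff L s • 1

theorem genInv_apply (s : G) (h : Hecke G) :
    genInv S L s h = genMul S L s h - quadCoeff L s • h := rfl

theorem genMul_std_of_lt {s w : G} (h : len S w < len S (s * w)) :
    genMul S L s (stdBasis w) = stdBasis (s * w) := by
  simp [genMul, h]

theorem genMul_std_of_gt {s w : G} (h : len S (s * w) < len S w) :
    genMul S L s (stdBasis w) = stdBasis (s * w) + quadCoeff L s • stdBasis w := by
  simp only [genMul, Finsupp.linearCombination_single, one_smul, if_neg h.not_gt]
  rfl

omit [Group G] in
theorem hecke_hom_ext {M : Type*} [AddCommMonoid M] [Module LaurentA M]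
    {f g : Hecke G →ₗ[LaurentA] M} (h : ∀ w, f (stdBasis w) = g (stdBasis w)) : f = g :=
  Finsupp.lhom_ext' fun w => LinearMap.ext_ring (h w)

variable (hS : IsExchangeSystem S)
include hS

theorem genMul_genMul {s : G} (hs : s ∈ S) (h : Hecke G) :
    genMul S L s (genMul S L s h) = h + quadCoeff L s • genMul S L s h := by
  suffices genMul S L s * genMul S L s = 1 + quadCoeff L s • genMul S L s from
    LinearMap.congr_fun this h
  refine hecke_hom_ext fun w => ?_
  simp only [Module.End.mul_apply, LinearMap.add_apply, Module.End.one_apply, LinearMap.smul_apply]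
  rcases hS.len_gen_mul hs w with h | h
  · rw [genMul_std_of_lt (by omega), genMul_std_of_gt (by
      rw [hS.mul_mul_cancel_left hs]; omega), hS.mul_mul_cancel_left hs]
  · rw [genMul_std_of_gt (by omega), map_add, map_smul, genMul_std_of_lt (by
      rw [hS.mul_mul_cancel_left hs]; omega), hS.mul_mul_cancel_left hs,
      genMul_std_of_gt (by omega)]

theorem genMul_genInv {s : G} (hs : s ∈ S) (h : Hecke G) :
    genMul S L s (genInv S L s h) = h := by
  rw [genInv_apply, map_sub, genMul_genMul hS hs, map_smul, add_sub_cancel_right]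

theorem genInv_genMul {s : G} (hs : s ∈ S) (h : Hecke G) :
    genInv S L s (genMul S L s h) = h := by
  rw [genInv_apply, genMul_genMul hS hs, add_sub_cancel_right]

theorem genMul_mul_genInv {s : G} (hs : s ∈ S) : genMul S L s * genInv S L s = 1 := by
  refine LinearMap.ext fun h => ?_
  rw [Module.End.mul_apply, genMul_genInv hS hs, Module.End.one_apply]

theorem genInv_mul_genMul {s : G} (hs : s ∈ S) : genInv S L s * genMul S L s = 1 := by
  refine LinearMap.ext fun h => ?_
  rw [Module.End.mul_apply, genInv_genMul hS hs, Module.End.one_apply]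

/-- Right multiplication by `T_t`, obtained from left multiplication by the anti-automorphism
`T_w ↦ T_{w⁻¹}`. -/
def genMulRight (S : Set G) (L : G → ℤ) (t : G) : Module.End LaurentA (Hecke G) :=
  Finsupp.lmapDomain LaurentA LaurentA (·⁻¹) ∘ₗ genMul S L t ∘ₗ
    Finsupp.lmapDomain LaurentA LaurentA (·⁻¹)

theorem genMulRight_std_of_lt {t w : G} (ht : t ∈ S) (h : len S w < len S (w * t)) :
    genMulRight S L t (stdBasis w) = stdBasis (w * t) := by
  have : len S w⁻¹ < len S (t * w⁻¹) := by
    rw [hS.len_inv, ← hS.len_inv (t * w⁻¹), mul_inv_rev, inv_inv, hS.inv_eq ht]; exact h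
  simp [genMulRight, genMul_std_of_lt this, hS.inv_eq ht]

theorem genMulRight_std_of_gt {t w : G} (ht : t ∈ S) (h : len S (w * t) < len S w) :
    genMulRight S L t (stdBasis w) = stdBasis (w * t) + quadCoeff L t • stdBasis w := by
  have : len S (t * w⁻¹) < len S w⁻¹ := by
    rw [hS.len_inv, ← hS.len_inv (t * w⁻¹), mul_inv_rev, inv_inv, hS.inv_eq ht]; exact h
  have e := genMul_std_of_gt (L := L) this
  simp only [genMulRight, LinearMap.comp_apply, Finsupp.lmapDomain_apply,
    Finsupp.mapDomain_single, e, Finsupp.mapDomain_add, Finsupp.mapDomain_smul, mul_inv_rev,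
    inv_inv, hS.inv_eq ht]

variable (hL : IsPositiveWeight S L)
include hL

theorem weight_eq_of_gen_mul_eq {s t w : G} (hs : s ∈ S) (ht : t ∈ S) (h : s * w = w * t) :
    L s = L t := by
  rcases hS.len_gen_mul hs w with h1 | h1
  · have h2 := hL.map_mul s w (by rw [hS.len_gen hs]; omega)
    have h3 := hL.map_mul w t (by rw [hS.len_gen ht, ← h]; omega)
    rw [h] at h2
    omega
  · have h2 := hL.map_mul s (s * w) (by
      rw [hS.len_gen hs, hS.mul_mul_cancel_left hs]; omega)
    have h3 := hL.map_mul (w * t) t (by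
      rw [hS.len_gen ht, hS.mul_mul_cancel_right ht, ← h]; omega)
    rw [hS.mul_mul_cancel_left hs, h] at h2
    rw [hS.mul_mul_cancel_right ht] at h3
    omega

/-- Left and right multiplications commute. This replaces Matsumoto's theorem in showing that left
multiplication by `T_w` does not depend on a reduced expression of `w`. -/
theorem genMul_genMulRight {s t : G} (hs : s ∈ S) (ht : t ∈ S) (h : Hecke G) :
    genMul S L s (genMulRight S L t h) = genMulRight S L t (genMul S L s h) := by
  suffices genMul S L s * genMulRight S L t = genMulRight S L t * genMul S L s from
    LinearMap.congr_fun this h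
  refine hecke_hom_ext fun w => ?_
  simp only [Module.End.mul_apply]
  have key := hS.gen_mul_eq_mul_gen (w := w) hs ht
  have a1 := hS.len_gen_mul hs w
  have a2 := hS.len_mul_gen ht w
  have a3 := hS.len_mul_gen ht (s * w)
  have a4 := hS.len_gen_mul hs (w * t)
  rw [← mul_assoc] at a4
  have lt1 := genMul_std_of_lt (S := S) (L := L) (s := s) (w := w)
  have gt1 := genMul_std_of_gt (S := S) (L := L) (s := s) (w := w)
  have lt2 := genMulRight_std_of_lt (L := L) hS (w := w) ht
  have gt2 := genMulRight_std_of_gt (L := L) hS (w := w) ht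
  have lt3 := genMulRight_std_of_lt (L := L) hS (w := s * w) ht
  have gt3 := genMulRight_std_of_gt (L := L) hS (w := s * w) ht
  have lt4 := genMul_std_of_lt (S := S) (L := L) (s := s) (w := w * t)
  have gt4 := genMul_std_of_gt (S := S) (L := L) (s := s) (w := w * t)
  rw [← mul_assoc] at lt4 gt4
  have hw : s * w = w * t → quadCoeff L s = quadCoeff L t := fun h => by
    rw [quadCoeff, quadCoeff, weight_eq_of_gen_mul_eq hS hL hs ht h]
  rcases a1 with a1 | a1 <;> rcases a2 with a2 | a2 <;> rcases a3 with a3 | a3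
  · rw [lt1 (by omega), lt2 (by omega), lt3 (by omega), lt4 (by omega)]
  · have e := key (by omega) (by omega)
    rw [lt1 (by omega), lt2 (by omega), gt3 (by omega), gt4 (by omega), hw e, e]
  · omega
  · rw [lt1 (by omega), gt2 (by omega), gt3 (by omega), map_add, map_smul, lt4 (by omega),
      lt1 (by omega)]
  · rw [gt1 (by omega), lt2 (by omega), map_add, map_smul, gt4 (by omega), lt3 (by omega),
      lt2 (by omega)]
  · omega
  · have e := key (by omega) (by omega)
    rw [gt1 (by omega), gt2 (by omega), map_add, map_add, map_smul, map_smul, lt4 (by omega),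
      lt3 (by omega), gt1 (by omega), gt2 (by omega), hw e, e]
  · rw [gt1 (by omega), gt2 (by omega), map_add, map_add, map_smul, map_smul, gt4 (by omega),
      gt3 (by omega), gt1 (by omega), gt2 (by omega)]
    module

omit hL in
/-- An operator commuting with all right multiplications is determined by its value at `T_1`. -/
theorem end_ext_of_commute {f g : Module.End LaurentA (Hecke G)}
    (hf : ∀ t ∈ S, ∀ h, f (genMulRight S L t h) = genMulRight S L t (f h))
    (hg : ∀ t ∈ S, ∀ h, g (genMulRight S L t h) = genMulRight S L t (g h))
    (h1 : f (stdBasis 1) = g (stdBasis 1)) : f = g := by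
  refine hecke_hom_ext fun w => ?_
  rw [← inv_inv w]
  generalize w⁻¹ = w
  induction w using hS.induction_left with
  | one => simpa using h1
  | mul s hs w hlen ih =>
    have h2 : len S w⁻¹ < len S (w⁻¹ * s) := by
      rw [← hS.len_inv (w⁻¹ * s), mul_inv_rev, inv_inv, hS.inv_eq hs, hS.len_inv]; omega
    rw [mul_inv_rev, hS.inv_eq hs, ← genMulRight_std_of_lt hS hs h2, hf s hs, hg s hs, ih]

omit hL in
theorem prod_genMul_std_one {l : List G} (hl : ∀ s ∈ l, s ∈ S) (hr : l.length = len S l.prod) :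
    (l.map (genMul S L)).prod (stdBasis 1) = stdBasis l.prod := by
  induction l with
  | nil => simp
  | cons s l ih =>
    have hs : s ∈ S := hl s List.mem_cons_self
    have hl2 : ∀ a ∈ l, a ∈ S := fun a ha => hl a (List.mem_cons_of_mem _ ha)
    have h1 := len_prod_le hl2
    have h2 := hS.len_gen_mul hs l.prod
    rw [List.prod_cons, List.length_cons] at hr
    rw [List.map_cons, List.prod_cons, Module.End.mul_apply, ih hl2 (by omega),
      genMul_std_of_lt (by omega), List.prod_cons]

theorem prod_genMul_genMulRight {l : List G} (hl : ∀ s ∈ l, s ∈ S) {t : G} (ht : t ∈ S)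
    (h : Hecke G) : (l.map (genMul S L)).prod (genMulRight S L t h) =
      genMulRight S L t ((l.map (genMul S L)).prod h) := by
  induction l with
  | nil => simp
  | cons s l ih =>
    rw [List.map_cons, List.prod_cons, Module.End.mul_apply, Module.End.mul_apply,
      ih fun a ha => hl a (List.mem_cons_of_mem _ ha),
      genMul_genMulRight hS hL (hl s List.mem_cons_self) ht]

theorem heckeMul_std_prod {l : List G} (hl : ∀ s ∈ l, s ∈ S) (hr : l.length = len S l.prod) :
    heckeMul S L (stdBasis l.prod) = (l.map (genMul S L)).prod := by
  obtain ⟨h1, h2, h3⟩ := hS.reducedWord_spec l.prod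
  simp only [heckeMul, Finsupp.linearCombination_single, one_smul]
  refine end_ext_of_commute hS (fun t ht h => prod_genMul_genMulRight hS hL h1 ht h)
    (fun t ht h => prod_genMul_genMulRight hS hL hl ht h) ?_
  rw [prod_genMul_std_one hS hl hr, prod_genMul_std_one hS h1 (by rw [h2, h3]), h2]

theorem heckeMul_std_mul {a b : G} (h : len S (a * b) = len S a + len S b) :
    heckeMul S L (stdBasis (a * b)) = heckeMul S L (stdBasis a) * heckeMul S L (stdBasis b) := by
  obtain ⟨l, hl, rfl, hl'⟩ := hS.exists_reduced a
  obtain ⟨m, hm, rfl, hm'⟩ := hS.exists_reduced b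
  rw [heckeMul_std_prod hS hL hl hl', heckeMul_std_prod hS hL hm hm', ← List.prod_append,
    heckeMul_std_prod hS hL, List.map_append, List.prod_append]
  · exact fun s hs => (List.mem_append.1 hs).elim (hl s) (hm s)
  · rw [List.length_append, List.prod_append, h, hl', hm']

theorem heckeMul_std_one : heckeMul S L (stdBasis 1) = 1 := by
  have := heckeMul_std_prod hS hL (l := []) (by simp) (by simp [len_one])
  simpa using this

theorem heckeMul_std_gen {s : G} (hs : s ∈ S) : heckeMul S L (stdBasis s) = genMul S L s := by
  have := heckeMul_std_prod hS hL (l := [s]) (by simpa using hs) (by simp [hS.len_gen hs])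
  simpa using this

theorem heckeMul_std_gen_mul {s w : G} (hs : s ∈ S) (h : len S (s * w) = len S w + 1) :
    heckeMul S L (stdBasis (s * w)) = genMul S L s * heckeMul S L (stdBasis w) := by
  rw [heckeMul_std_mul hS hL (by rw [hS.len_gen hs]; omega), heckeMul_std_gen hS hL hs]

/-! ### The bar involution -/

omit hS hL in
theorem inverse_mul_of_isUnit {R : Type*} [MonoidWithZero R] {x y z : R} (hx : IsUnit x)
    (h1 : y * z = 1) (h2 : z * y = 1) : Ring.inverse (x * y) = z * Ring.inverse x := by
  obtain ⟨u, rfl⟩ := hx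
  have e : (u * y : R) = ((u * ⟨y, z, h1, h2⟩ : Rˣ) : R) := rfl
  rw [e, Ring.inverse_unit, Ring.inverse_unit, mul_inv_rev, Units.val_mul]
  rfl

theorem isUnit_heckeMul_std (w : G) : IsUnit (heckeMul S L (stdBasis w)) := by
  induction w using hS.induction_left with
  | one => rw [heckeMul_std_one hS hL]; exact isUnit_one
  | mul s hs w hlen ih =>
    rw [heckeMul_std_gen_mul hS hL hs hlen]
    exact IsUnit.mul ⟨⟨_, _, genMul_mul_genInv hS hs, genInv_mul_genMul hS hs⟩, rfl⟩ ih

theorem invStd_one : invStd S L (1 : G) = stdBasis 1 := by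
  rw [invStd, inv_one, heckeMul_std_one hS hL, Ring.inverse_one]
  rfl

theorem invStd_gen_mul {s w : G} (hs : s ∈ S) (h : len S (s * w) = len S w + 1) :
    invStd S L (s * w) = genInv S L s (invStd S L w) := by
  have e : heckeMul S L (stdBasis (s * w)⁻¹) = heckeMul S L (stdBasis w⁻¹) * genMul S L s := by
    rw [mul_inv_rev, hS.inv_eq hs, heckeMul_std_mul hS hL, heckeMul_std_gen hS hL hs]
    rw [← hS.len_inv (w⁻¹ * s), mul_inv_rev, inv_inv, hS.inv_eq hs, hS.len_inv, hS.len_gen hs]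
    omega
  rw [invStd, e, invStd, inverse_mul_of_isUnit (isUnit_heckeMul_std hS hL w⁻¹)
    (genMul_mul_genInv hS hs) (genInv_mul_genMul hS hs),
    Module.End.mul_apply]

omit hS hL in
theorem bar_add (h h' : Hecke G) : bar S L (h + h') = bar S L h + bar S L h' := by
  classical
  exact Finsupp.sum_add_index' (by simp) (by simp [add_smul])

omit hS hL in
theorem bar_smul (a : LaurentA) (h : Hecke G) :
    bar S L (a • h) = LaurentPolynomial.invert a • bar S L h := by
  rw [bar, Finsupp.sum_smul_index (by simp), bar, Finsupp.smul_sum]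
  simp [mul_smul]

omit hS hL in
theorem bar_std (w : G) : bar S L (stdBasis w) = invStd S L w := by
  rw [bar, Finsupp.sum_single_index] <;> simp

/-- The bar involution as an additive map. -/
def barHom (S : Set G) (L : G → ℤ) : Hecke G →+ Hecke G :=
  AddMonoidHom.mk' (bar S L) bar_add

omit hS hL in
theorem barHom_apply (h : Hecke G) : barHom S L h = bar S L h := rfl

theorem bar_genMul {s : G} (hs : s ∈ S) (h : Hecke G) :
    bar S L (genMul S L s h) = genInv S L s (bar S L h) := by
  induction h using Finsupp.induction_linear with
  | zero =>
    rw [map_zero, ← barHom_apply, map_zero, map_zero]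
  | add h h' ih ih' => rw [map_add, bar_add, ih, ih', bar_add, map_add]
  | single w a =>
    have e : (Finsupp.single w a : Hecke G) = a • stdBasis w := by simp
    rw [e, map_smul, bar_smul, bar_smul, map_smul]
    congr 1
    rcases hS.len_gen_mul hs w with h | h
    · rw [genMul_std_of_lt (by omega), bar_std, bar_std, invStd_gen_mul hS hL hs h]
    · have h1 := invStd_gen_mul (L := L) hS hL (s := s) (w := s * w) hs (by
        rw [hS.mul_mul_cancel_left hs]; omega)
      rw [hS.mul_mul_cancel_left hs] at h1
      rw [genMul_std_of_gt (by omega), bar_add, bar_smul, invert_quadCoeff, bar_std, bar_std,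
        genInv_apply, h1, genMul_genInv hS hs, neg_smul, sub_eq_add_neg]

theorem bar_genInv {s : G} (hs : s ∈ S) (h : Hecke G) :
    bar S L (genInv S L s h) = genMul S L s (bar S L h) := by
  rw [genInv_apply, ← barHom_apply, map_sub, barHom_apply, barHom_apply, bar_genMul hS hL hs,
    bar_smul, invert_quadCoeff, genInv_apply]
  module

theorem bar_bar (h : Hecke G) : bar S L (bar S L h) = h := by
  induction h using Finsupp.induction_linear with
  | zero => simp only [← barHom_apply, map_zero]
  | add h h' ih ih' => rw [bar_add, bar_add, ih, ih']
  | single w a =>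
    have e : (Finsupp.single w a : Hecke G) = a • stdBasis w := by simp
    rw [e, bar_smul, bar_smul, LaurentPolynomial.involutive_invert]
    congr 1
    induction w using hS.induction_left with
    | one => rw [bar_std, invStd_one hS hL, bar_std, invStd_one hS hL]
    | mul s hs w hlen ih =>
      rw [← genMul_std_of_lt (S := S) (L := L) (by omega), bar_genMul hS hL hs, bar_genInv hS hL hs,
        ih (by simp)]

omit hL in
theorem genMul_mem_span_len_lt {s : G} (hs : s ∈ S) {n : ℕ} {h : Hecke G}
    (hh : h ∈ Submodule.span LaurentA (stdBasis '' {y : G | len S y < n})) :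
    genMul S L s h ∈ Submodule.span LaurentA (stdBasis '' {y : G | len S y < n + 1}) := by
  induction hh using Submodule.span_induction with
  | zero => simp
  | add x y _ _ hx hy => rw [map_add]; exact add_mem hx hy
  | smul a x _ hx => rw [map_smul]; exact Submodule.smul_mem _ _ hx
  | mem x hx =>
    obtain ⟨y, hy, rfl⟩ := hx
    simp only [Set.mem_ofPred_eq] at hy
    rcases hS.len_gen_mul hs y with h | h
    · rw [genMul_std_of_lt (by omega)]
      exact Submodule.subset_span ⟨_, by simp only [Set.mem_ofPred_eq]; omega, rfl⟩
    · rw [genMul_std_of_gt (by omega)]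
      exact add_mem (Submodule.subset_span ⟨_, by simp only [Set.mem_ofPred_eq]; omega, rfl⟩)
        (Submodule.smul_mem _ _ (Submodule.subset_span
          ⟨_, by simp only [Set.mem_ofPred_eq]; omega, rfl⟩))

theorem bar_std_sub_mem (w : G) : bar S L (stdBasis w) - stdBasis w ∈
    Submodule.span LaurentA (stdBasis '' {y : G | len S y < len S w}) := by
  have hmono : ∀ {m n : ℕ}, m ≤ n →
      Submodule.span LaurentA ((stdBasis : G → Hecke G) '' {y : G | len S y < m}) ≤
      Submodule.span LaurentA (stdBasis '' {y : G | len S y < n}) := fun h =>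
    Submodule.span_mono (Set.image_mono fun y hy => lt_of_lt_of_le hy h)
  induction w using hS.induction_left with
  | one => rw [bar_std, invStd_one hS hL, sub_self]; exact zero_mem _
  | mul s hs w hlen ih =>
    rw [← genMul_std_of_lt (S := S) (L := L) (by omega), bar_genMul hS hL hs, genInv_apply, hlen]
    have e : genMul S L s (bar S L (stdBasis w)) - quadCoeff L s • bar S L (stdBasis w) -
        genMul S L s (stdBasis w) = genMul S L s (bar S L (stdBasis w) - stdBasis w) -
          quadCoeff L s • ((bar S L (stdBasis w) - stdBasis w) + stdBasis w) := by
      rw [map_sub, sub_add_cancel]; abel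
    rw [e]
    refine sub_mem (genMul_mem_span_len_lt hS hs ih) (Submodule.smul_mem _ _
      (add_mem (hmono (by omega) ih) (Submodule.subset_span ⟨w, ?_, rfl⟩)))
    simp only [Set.mem_ofPred_eq]; omega

end HeckeAlgebra

/-! ### Unitriangular families and bar-invariant bases -/

section Unitriangular

variable {ι R M : Type*} [Ring R] [AddCommGroup M] [Module R M] (b : Module.Basis ι R M)
  {c : ι → M} {r : ι → ι → Prop} {ℓ : ι → ℕ} (hr : ∀ y w, r y w → ℓ y < ℓ w)
  (hc : ∀ w, c w - b w ∈ Submodule.span R (b '' {y | r y w}))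
include hr hc

omit hr in
theorem repr_unitriangular {w z : ι} (h : ¬ r z w) (hz : z ≠ w) : b.repr (c w) z = 0 := by
  have h1 := (b.mem_span_image).1 (hc w)
  by_contra h2
  have h3 : b.repr (c w - b w) z ≠ 0 := by
    rw [map_sub, Finsupp.sub_apply, b.repr_self, Finsupp.single_eq_of_ne hz, sub_zero]
    exact h2
  exact h (h1 (Finsupp.mem_support_iff.2 h3))

theorem repr_unitriangular_self (w : ι) : b.repr (c w) w = 1 := by
  have h1 := (b.mem_span_image).1 (hc w)
  have h3 : b.repr (c w - b w) w = 0 := by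
    by_contra h
    exact lt_irrefl _ (hr w w (h1 (Finsupp.mem_support_iff.2 h)))
  rw [map_sub, Finsupp.sub_apply, b.repr_self, Finsupp.single_eq_same] at h3
  exact sub_eq_zero.1 h3

theorem linearIndependent_of_unitriangular : LinearIndependent R c := by
  rw [linearIndependent_iff]
  intro f hf
  by_contra hne
  obtain ⟨w, hw, hmax⟩ := Finset.exists_max_image f.support ℓ (Finsupp.support_nonempty_iff.2 hne)
  have h1 := congrArg (fun m => b.repr m w) hf
  simp only [Finsupp.linearCombination_apply, Finsupp.sum, map_sum, map_smul,
    Finsupp.finsetSum_apply, Finsupp.smul_apply, map_zero, Finsupp.coe_zero, Pi.zero_apply] at h1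
  rw [Finset.sum_eq_single_of_mem w hw] at h1
  · rw [repr_unitriangular_self b hr hc, smul_eq_mul, mul_one] at h1
    exact Finsupp.mem_support_iff.1 hw h1
  · intro z hz hzw
    rw [repr_unitriangular b hc (fun h => (hr _ _ h).not_ge (hmax z hz)) hzw.symm, smul_zero]

theorem span_image_unitriangular {D : Set ι} (hD : ∀ y w, r y w → w ∈ D → y ∈ D) :
    Submodule.span R (c '' D) = Submodule.span R (b '' D) := by
  have hsub : ∀ w ∈ D, c w - b w ∈ Submodule.span R (b '' D) := fun w hw =>
    Submodule.span_mono (Set.image_mono fun y hy => hD y w hy hw) (hc w)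
  apply le_antisymm
  · rw [Submodule.span_le]
    rintro _ ⟨w, hw, rfl⟩
    rw [← sub_add_cancel (c w) (b w)]
    exact add_mem (hsub w hw) (Submodule.subset_span ⟨w, hw, rfl⟩)
  · rw [Submodule.span_le]
    rintro _ ⟨w, hw, rfl⟩
    induction hn : ℓ w using Nat.strong_induction_on generalizing w with
    | _ n ih =>
      subst hn
      have h1 : c w - b w ∈ Submodule.span R (c '' D) := by
        refine Submodule.span_le.2 ?_ (hc w)
        rintro _ ⟨y, hy, rfl⟩
        exact ih _ (hr y w hy) y (hD y w hy hw) rfl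
      have h2 := sub_mem (Submodule.subset_span ⟨w, hw, rfl⟩ : c w ∈ Submodule.span R (c '' D)) h1
      rwa [sub_sub_cancel] at h2

/-- A unitriangular family is a basis. -/
def unitriangularBasis : Module.Basis ι R M :=
  Module.Basis.mk (linearIndependent_of_unitriangular b hr hc) (by
    rw [← Set.image_univ, span_image_unitriangular b hr hc fun _ _ _ _ => Set.mem_univ _,
      Set.image_univ, b.span_eq])

@[simp] theorem unitriangularBasis_apply (w : ι) : unitriangularBasis b hr hc w = c w := by
  simp [unitriangularBasis]

end Unitriangular

section BarInvariant

/-- `v⁻¹ℤ[v⁻¹]`. -/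
def negLaurent : AddSubgroup LaurentA where
  carrier := {a | ∀ n : ℤ, a.coeff n ≠ 0 → n < 0}
  zero_mem' := by intro n h; simp at h
  add_mem' := by
    intro a b ha hb n h
    by_contra hn
    refine h ?_
    rw [AddMonoidAlgebra.coeff_add, Finsupp.add_apply, not_not.1 (mt (ha n) hn),
      not_not.1 (mt (hb n) hn), add_zero]
  neg_mem' := by
    intro a ha n h
    refine ha n ?_
    simpa using h

theorem mul_mem_negLaurent {a b : LaurentA} (ha : a ∈ negLaurent) (hb : b ∈ negLaurent) :
    a * b ∈ negLaurent := by
  classical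
  intro n hn
  have := AddMonoidAlgebra.support_coeff_mul_subset (x := a) (y := b) (Finsupp.mem_support_iff.2 hn)
  obtain ⟨i, hi, j, hj, rfl⟩ := Finset.mem_add.1 this
  have h1 := ha i (Finsupp.mem_support_iff.1 hi)
  have h2 := hb j (Finsupp.mem_support_iff.1 hj)
  omega

theorem eq_zero_of_invert_eq {a : LaurentA} (ha : a ∈ negLaurent)
    (h : LaurentPolynomial.invert a = a) : a = 0 := by
  ext n
  by_contra hn
  have h1 := ha n hn
  have h2 : a.coeff (-n) ≠ 0 := by rw [← LaurentPolynomial.invert_apply, h]; exact hn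
  have := ha (-n) h2
  omega

/-- The part of a Laurent polynomial in `v⁻¹ℤ[v⁻¹]`. -/
def truncNeg (a : LaurentA) : LaurentA :=
  AddMonoidAlgebra.ofCoeff (a.coeff.filter (· < 0))

theorem truncNeg_mem (a : LaurentA) : truncNeg a ∈ negLaurent := by
  intro n hn
  by_contra h
  exact hn (by simp [truncNeg, h])

theorem truncNeg_zero : truncNeg 0 = 0 := by
  ext n; simp [truncNeg, Finsupp.filter_apply]

theorem add_invert_truncNeg {a : LaurentA} (h : LaurentPolynomial.invert a = -a) :
    a + LaurentPolynomial.invert (truncNeg a) = truncNeg a := by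
  ext n
  have h1 := congrArg (fun a : LaurentA => a.coeff n) h
  simp only [LaurentPolynomial.invert_apply, AddMonoidAlgebra.coeff_neg, Finsupp.neg_apply] at h1
  simp only [AddMonoidAlgebra.coeff_add, Finsupp.add_apply, LaurentPolynomial.invert_apply,
    truncNeg, AddMonoidAlgebra.coeff_ofCoeff, Finsupp.filter_apply]
  rcases lt_trichotomy n 0 with hn | rfl | hn
  · simp [hn, hn.le]
  · simp at h1 ⊢; omega
  · simp [hn, hn.not_gt, h1]

variable {ι M : Type*} [AddCommGroup M] [Module LaurentA M] (b : Module.Basis ι LaurentA M)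
  {r : ι → ι → Prop} {ℓ : ι → ℕ} (hr : ∀ y w, r y w → ℓ y < ℓ w)
  {β : M →+ M} (hβ : ∀ (a : LaurentA) (m : M), β (a • m) = LaurentPolynomial.invert a • β m)
  (htri : ∀ w, β (b w) - b w ∈ Submodule.span LaurentA (b '' {y | r y w}))
include hr hβ htri

/-- There is no nonzero bar-invariant element with all coordinates in `v⁻¹ℤ[v⁻¹]`. -/
theorem eq_zero_of_bar_invariant {m : M} (hm : β m = m) (hneg : ∀ y, b.repr m y ∈ negLaurent) :
    m = 0 := by
  by_contra hne
  have hne' : b.repr m ≠ 0 := fun h => hne (b.repr.map_eq_zero_iff.1 h)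
  -- The coordinate of `m` at a maximal element of its support is itself invariant.
  obtain ⟨w, hw, hmax⟩ := Finset.exists_max_image _ ℓ (Finsupp.support_nonempty_iff.2 hne')
  refine Finsupp.mem_support_iff.1 hw (eq_zero_of_invert_eq (hneg w) ?_)
  have h1 : b.repr (β m) w = LaurentPolynomial.invert (b.repr m w) := by
    conv_lhs => rw [← b.linearCombination_repr m]
    simp only [Finsupp.linearCombination_apply, Finsupp.sum, map_sum, hβ, map_smul,
      Finsupp.finsetSum_apply, Finsupp.smul_apply]
    rw [Finset.sum_eq_single_of_mem w hw]
    · rw [repr_unitriangular_self b hr htri, smul_eq_mul, mul_one]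
    · intro z hz hzw
      rw [repr_unitriangular b htri (fun h => (hr _ _ h).not_ge (hmax z hz)) hzw.symm, smul_zero]
  rw [← h1, hm]

/-- The Kazhdan–Lusztig lemma: a semilinear involution that is unitriangular with respect to a
basis has an invariant element in `b w + ∑ v⁻¹ℤ[v⁻¹] b y` for each `w`, and the sum can be taken
over the `y` strictly below `w`. -/
theorem exists_bar_invariant (htrans : ∀ x y z, r x y → r y z → r x z)
    (hinv : ∀ m, β (β m) = m) (w : ι) :
    ∃ c, β c = c ∧ (∀ y, b.repr (c - b w) y ∈ negLaurent) ∧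
      c - b w ∈ Submodule.span LaurentA (b '' {y | r y w}) := by
  classical
  induction hn : ℓ w using Nat.strong_induction_on generalizing w with
  | _ n ih =>
    subst hn
    have ih' : ∀ y, ∃ c, (r y w → β c = c) ∧ (∀ z, b.repr (c - b y) z ∈ negLaurent) ∧
        c - b y ∈ Submodule.span LaurentA (b '' {z | r z y}) := by
      intro y
      by_cases h : r y w
      · obtain ⟨c, h1, h2, h3⟩ := ih _ (hr y w h) y rfl
        exact ⟨c, fun _ => h1, h2, h3⟩
      · exact ⟨b y, fun h' => absurd h' h, fun z => by simp [zero_mem], by simp⟩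
    choose c hc1 hc2 hc3 using ih'
    -- Write `β (b w) - b w = ∑ q_y c_y`; applying `β` gives `invert q_y = -q_y`, so that
    -- `q_y = p_y - invert p_y` with `p_y ∈ v⁻¹ℤ[v⁻¹]`, and `b w + ∑ p_y c_y` is invariant.
    have hD := htri w
    rw [← span_image_unitriangular b hr hc3 (D := {y | r y w})
        fun x y hxy hy => htrans x y w hxy hy,
      Finsupp.mem_span_image_iff_linearCombination] at hD
    obtain ⟨q, hq, hqD⟩ := hD
    have hβq : ∀ p : ι →₀ LaurentA, (∀ y, p y ≠ 0 → r y w) →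
        β (Finsupp.linearCombination LaurentA c p) = Finsupp.linearCombination LaurentA c
          (p.mapRange LaurentPolynomial.invert (map_zero _)) := by
      intro p hp
      rw [Finsupp.linearCombination_apply, Finsupp.linearCombination_apply,
        Finsupp.sum_mapRange_index (by simp), Finsupp.sum, map_sum, Finsupp.sum]
      refine Finset.sum_congr rfl fun y hy => ?_
      rw [hβ, hc1 y (hp y (Finsupp.mem_support_iff.1 hy))]
    have hqr : ∀ y, q y ≠ 0 → r y w := fun y hy => hq (Finsupp.mem_support_iff.2 hy)
    have hqinv : ∀ y, LaurentPolynomial.invert (q y) = -q y := by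
      have h1 : Finsupp.linearCombination LaurentA c
          (q.mapRange LaurentPolynomial.invert (map_zero _)) =
          Finsupp.linearCombination LaurentA c (-q) := by
        rw [← hβq q hqr, hqD, map_neg, hqD, map_sub, hinv, neg_sub]
      have h2 := linearIndependent_of_unitriangular b hr hc3 h1
      intro y
      have := DFunLike.congr_fun h2 y
      simpa using this
    set p : ι →₀ LaurentA := q.mapRange truncNeg truncNeg_zero with hp
    have hpr : ∀ y, p y ≠ 0 → r y w := by
      intro y hy
      refine hqr y fun h => hy ?_
      rw [hp, Finsupp.mapRange_apply, h, truncNeg_zero]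
    have hsub : ∀ y, r y w → c y ∈ Submodule.span LaurentA (b '' {y | r y w}) := by
      intro y hy
      rw [← span_image_unitriangular b hr hc3 (D := {y | r y w})
        fun x y hxy hy => htrans x y w hxy hy]
      exact Submodule.subset_span ⟨y, hy, rfl⟩
    refine ⟨b w + Finsupp.linearCombination LaurentA c p, ?_, ?_, ?_⟩
    · rw [map_add, hβq p hpr]
      have h1 : β (b w) = b w + Finsupp.linearCombination LaurentA c q := by rw [hqD]; abel
      rw [h1, add_assoc, ← map_add]
      congr 2
      ext1 y
      exact add_invert_truncNeg (hqinv y)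
    · intro y
      rw [add_sub_cancel_left, Finsupp.linearCombination_apply, Finsupp.sum, map_sum,
        Finsupp.finsetSum_apply]
      refine sum_mem fun z _ => ?_
      rw [map_smul, Finsupp.smul_apply, smul_eq_mul]
      have hpz : p z ∈ negLaurent := truncNeg_mem _
      have h1 : b.repr (c z) y = b.repr (c z - b z) y + b.repr (b z) y := by
        rw [← Finsupp.add_apply, ← map_add, sub_add_cancel]
      rw [h1, mul_add]
      refine add_mem (mul_mem_negLaurent hpz (hc2 z y)) ?_
      rw [b.repr_self, Finsupp.single_apply]
      split_ifs
      · rwa [mul_one]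
      · rw [mul_zero]; exact zero_mem _
    · rw [add_sub_cancel_left, Finsupp.linearCombination_apply, Finsupp.sum]
      exact sum_mem fun z hz => Submodule.smul_mem _ _
        (hsub z (hpr z (Finsupp.mem_support_iff.1 hz)))

end BarInvariant

/-! ### The Kazhdan–Lusztig basis and the left preorder -/

section KazhdanLusztig

variable {S : Set G} {L : G → ℤ}

theorem leftLE_refl (w : G) : LeftLE S L w w := Relation.ReflTransGen.refl

theorem leftLE_trans {x y z : G} (h : LeftLE S L x y) (h' : LeftLE S L y z) : LeftLE S L x z :=
  Relation.ReflTransGen.trans h h'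

/-- The basis `T_w` as a `Module.Basis`. -/
def stdB (G : Type*) : Module.Basis G LaurentA (Hecke G) := Finsupp.basisSingleOne

omit [Group G] in
@[simp] theorem stdB_apply (w : G) : stdB G w = stdBasis w := by simp [stdB]

omit [Group G] in
theorem coe_stdB : ⇑(stdB G) = stdBasis := funext stdB_apply

theorem isKLElement_iff {w : G} {c : Hecke G} : IsKLElement S L w c ↔
    bar S L c = c ∧ ∀ y, (c - stdBasis w) y ∈ negLaurent := Iff.rfl

variable (hS : IsExchangeSystem S) (hL : IsPositiveWeight S L)
include hS hL

theorem isKLElement_unique {w : G} {c c' : Hecke G} (h : IsKLElement S L w c)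
    (h' : IsKLElement S L w c') : c = c' := by
  rw [isKLElement_iff] at h h'
  refine sub_eq_zero.1 (eq_zero_of_bar_invariant (stdB G) (r := fun y w => len S y < len S w)
    (ℓ := len S) (fun _ _ h => h) (β := barHom S L) bar_smul ?_ ?_ ?_)
  · intro w
    rw [coe_stdB, barHom_apply]
    exact bar_std_sub_mem hS hL w
  · rw [map_sub, barHom_apply, barHom_apply, h.1, h'.1]
  · intro y
    have := sub_mem (h.2 y) (h'.2 y)
    rwa [← Finsupp.sub_apply, sub_sub_sub_cancel_right] at this

theorem klBasis_spec_aux (w : G) : IsKLElement S L w (klBasis S L w) ∧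
    klBasis S L w - stdBasis w ∈ Submodule.span LaurentA (stdBasis '' {y | len S y < len S w}) := by
  obtain ⟨c, h1, h2, h3⟩ := exists_bar_invariant (stdB G) (r := fun y w => len S y < len S w)
    (ℓ := len S) (fun _ _ h => h) (β := barHom S L) bar_smul (fun w => by
      rw [coe_stdB, barHom_apply]; exact bar_std_sub_mem hS hL w)
    (fun _ _ _ => lt_trans) (bar_bar hS hL) w
  rw [coe_stdB] at h3
  have h4 : IsKLElement S L w c := isKLElement_iff.2 ⟨h1, h2⟩
  have h5 : IsKLElement S L w (klBasis S L w) := Classical.epsilon_spec ⟨c, h4⟩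
  rw [isKLElement_unique hS hL h5 h4]
  exact ⟨h4, h3⟩

theorem klBasis_spec (w : G) : IsKLElement S L w (klBasis S L w) := (klBasis_spec_aux hS hL w).1

theorem klBasis_sub_mem (w : G) : klBasis S L w - stdBasis w ∈
    Submodule.span LaurentA (stdBasis '' {y | len S y < len S w}) := (klBasis_spec_aux hS hL w).2

theorem klBasis_eq {w : G} {c : Hecke G} (h : IsKLElement S L w c) : klBasis S L w = c :=
  isKLElement_unique hS hL (klBasis_spec hS hL w) h

/-- The Kazhdan–Lusztig basis as a `Module.Basis`. -/
def klB : Module.Basis G LaurentA (Hecke G) :=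
  unitriangularBasis (stdB G) (c := klBasis S L) (r := fun y w => len S y < len S w) (ℓ := len S)
    (fun _ _ h => h) (fun w => by rw [coe_stdB]; exact klBasis_sub_mem hS hL w)

@[simp] theorem klB_apply (w : G) : klB hS hL w = klBasis S L w := by simp [klB]

theorem coe_klB : ⇑(klB hS hL) = klBasis S L := funext (klB_apply hS hL)

theorem klCoord_eq (h : Hecke G) : klCoord S L h = (klB hS hL).repr h := by
  have hinj : Function.Injective (Finsupp.linearCombination LaurentA (klBasis S L)) := by
    rw [← coe_klB hS hL]
    exact (klB hS hL).linearIndependent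
  have h1 := Function.leftInverse_invFun hinj ((klB hS hL).repr h)
  rwa [← coe_klB hS hL, (klB hS hL).linearCombination_repr, coe_klB] at h1

theorem klBasis_gen {s : G} (hs : s ∈ S) : klBasis S L s =
    stdBasis s + (LaurentPolynomial.T (-L s) : LaurentA) • stdBasis 1 := by
  refine klBasis_eq hS hL (isKLElement_iff.2 ⟨?_, fun y => ?_⟩)
  · have h1 := invStd_gen_mul hS hL hs (w := 1) (by rw [mul_one, hS.len_gen hs, len_one])
    have h2 := genMul_std_of_lt (S := S) (L := L) (s := s) (w := 1)
      (by rw [mul_one, hS.len_gen hs, len_one]; omega)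
    rw [mul_one] at h1 h2
    rw [bar_add, bar_smul, bar_std, bar_std, h1, invStd_one hS hL, genInv_apply, h2,
      LaurentPolynomial.invert_T, neg_neg, quadCoeff]
    module
  · classical
    rw [add_sub_cancel_left]
    intro n hn
    rw [Finsupp.smul_apply, Finsupp.single_apply] at hn
    split_ifs at hn
    · rw [smul_eq_mul, mul_one, LaurentPolynomial.T_apply] at hn
      have := hL.pos s hs
      split_ifs at hn with h
      · omega
      · exact absurd rfl hn
    · simp at hn

theorem heckeMul_klBasis_gen {s : G} (hs : s ∈ S) (h : Hecke G) :
    heckeMul S L (klBasis S L s) h =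
      genMul S L s h + (LaurentPolynomial.T (-L s) : LaurentA) • h := by
  rw [klBasis_gen hS hL hs, map_add, map_smul, heckeMul_std_gen hS hL hs, heckeMul_std_one hS hL]
  rfl

theorem klStruct_gen {s : G} (hs : s ∈ S) (w : G) : klStruct S L s w =
    (klB hS hL).repr (genMul S L s (klBasis S L w)) +
      (LaurentPolynomial.T (-L s) : LaurentA) • Finsupp.single w 1 := by
  rw [klStruct, klCoord_eq hS hL, heckeMul_klBasis_gen hS hL hs, map_add, map_smul,
    ← klB_apply hS hL w, (klB hS hL).repr_self]

theorem genMul_klBasis_mem {s : G} (hs : s ∈ S) (w : G) : genMul S L s (klBasis S L w) ∈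
    Submodule.span LaurentA (klBasis S L '' {y | LeftLE S L y w}) := by
  have h1 : heckeMul S L (klBasis S L s) (klBasis S L w) ∈
      Submodule.span LaurentA (klBasis S L '' {y | LeftLE S L y w}) := by
    rw [← coe_klB hS hL, (klB hS hL).mem_span_image]
    intro y hy
    refine Relation.ReflTransGen.single ⟨s, hs, ?_⟩
    rw [klStruct, klCoord_eq hS hL, ← coe_klB hS hL]
    exact Finsupp.mem_support_iff.1 hy
  rw [heckeMul_klBasis_gen hS hL hs] at h1
  have h2 := sub_mem h1 (Submodule.smul_mem _ (LaurentPolynomial.T (-L s) : LaurentA)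
    (Submodule.subset_span ⟨w, leftLE_refl w, rfl⟩))
  rwa [add_sub_cancel_right] at h2

/-- The left preorder is the smallest preorder for which the spans of the Kazhdan–Lusztig basis
elements below a given one are left ideals. -/
theorem rel_of_leftLE {r : G → G → Prop} (hrefl : ∀ x, r x x)
    (htrans : ∀ x y z, r x y → r y z → r x z)
    (h : ∀ s ∈ S, ∀ w, genMul S L s (klBasis S L w) ∈
      Submodule.span LaurentA (klBasis S L '' {y | r y w})) {y w : G} (hyw : LeftLE S L y w) :
    r y w := by
  induction hyw with
  | refl => exact hrefl _
  | @tail a b _ hstep ih =>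
    refine htrans _ _ _ ih ?_
    obtain ⟨s, hs, hne⟩ := hstep
    by_cases hab : a = b
    · rw [hab]; exact hrefl b
    rw [klStruct_gen hS hL hs, Finsupp.add_apply, Finsupp.smul_apply, Finsupp.single_eq_of_ne hab,
      smul_zero, add_zero] at hne
    have h1 := h s hs b
    rw [← coe_klB hS hL, (klB hS hL).mem_span_image, coe_klB] at h1
    exact h1 (Finsupp.mem_support_iff.2 hne)

theorem heckeMul_std_apply_std {a b : G} (h : len S (a * b) = len S a + len S b) :
    heckeMul S L (stdBasis a) (stdBasis b) = stdBasis (a * b) := by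
  have key : ∀ w, heckeMul S L (stdBasis w) (stdBasis 1) = stdBasis w := by
    intro w
    obtain ⟨l, hl, rfl, hl'⟩ := hS.exists_reduced w
    rw [heckeMul_std_prod hS hL hl hl', prod_genMul_std_one hS hl hl']
  rw [← key b, ← Module.End.mul_apply, ← heckeMul_std_mul hS hL h, key]

end KazhdanLusztig

/-! ### The Kazhdan–Lusztig basis relative to a parabolic subgroup -/

section Relative

/-- The restriction of a weight function to a parabolic subgroup. -/
abbrev parabolicWeight (L : G → ℤ) (I : Set G) : Subgroup.closure I → ℤ := fun w => L w

/-- The embedding of the Hecke algebra of a parabolic subgroup, `T_u ↦ T_u`. -/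
def parabolicIncl (I : Set G) : Hecke (Subgroup.closure I) →ₗ[LaurentA] Hecke G :=
  Finsupp.lmapDomain LaurentA LaurentA (fun u : Subgroup.closure I => (u : G))

@[simp] theorem parabolicIncl_std (I : Set G) (u : Subgroup.closure I) :
    parabolicIncl I (stdBasis u) = stdBasis (u : G) := by
  simp [parabolicIncl]

variable {S I : Set G} {L : G → ℤ} (hS : IsExchangeSystem S) (hL : IsPositiveWeight S L)
  (hI : I ⊆ S)

/-- The map `h ↦ T_x h` from the Hecke algebra of a parabolic subgroup. -/
def relMap (S : Set G) (L : G → ℤ) (I : Set G) (x : G) :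
    Hecke (Subgroup.closure I) →ₗ[LaurentA] Hecke G :=
  LinearMap.comp (heckeMul S L (stdBasis x)) (parabolicIncl I)

theorem relMap_apply (S : Set G) (L : G → ℤ) (I : Set G) (x : G) (h : Hecke (Subgroup.closure I)) :
    relMap S L I x h = heckeMul S L (stdBasis x) (parabolicIncl I h) := rfl

/-- The elements `T_x c_u`, where `c_u` is the Kazhdan–Lusztig basis of the parabolic subgroup. -/
def relFamily (S I : Set G) (L : G → ℤ) (p : minReps S I × Subgroup.closure I) : Hecke G :=
  relMap S L I p.1 (klBasis (parabolicGens I) (parabolicWeight L I) p.2)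

include hS hI

theorem parabolicIncl_genMul {t : Subgroup.closure I} (ht : (t : G) ∈ I)
    (h : Hecke (Subgroup.closure I)) :
    parabolicIncl I (genMul (parabolicGens I) (parabolicWeight L I) t h) =
      genMul S L t (parabolicIncl I h) := by
  suffices parabolicIncl I ∘ₗ genMul (parabolicGens I) (parabolicWeight L I) t =
      genMul S L t ∘ₗ parabolicIncl I from LinearMap.congr_fun this h
  refine hecke_hom_ext fun w => ?_
  simp only [LinearMap.comp_apply, parabolicIncl_std]
  have hw := len_parabolic hS hI w
  have htw := len_parabolic hS hI (t * w)
  rw [Subgroup.coe_mul] at htw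
  rcases hS.len_gen_mul (hI ht) w with h | h
  · rw [genMul_std_of_lt (by omega), genMul_std_of_lt (by omega), parabolicIncl_std,
      Subgroup.coe_mul]
  · rw [genMul_std_of_gt (by omega), genMul_std_of_gt (by omega), map_add, map_smul,
      parabolicIncl_std, parabolicIncl_std, Subgroup.coe_mul]
    rfl

include hL

theorem bar_parabolicIncl (h : Hecke (Subgroup.closure I)) :
    bar S L (parabolicIncl I h) =
      parabolicIncl I (bar (parabolicGens I) (parabolicWeight L I) h) := by
  have hSI := isExchangeSystem_parabolicGens hS hI
  have hLI := isPositiveWeight_parabolicGens hS hI hL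
  induction h using Finsupp.induction_linear with
  | zero => simp only [map_zero, ← barHom_apply]
  | add h h' ih ih' => rw [map_add, bar_add, ih, ih', bar_add, map_add]
  | single w a =>
    have e : (Finsupp.single w a : Hecke (Subgroup.closure I)) = a • stdBasis w := by simp
    rw [e, map_smul, bar_smul, bar_smul, map_smul]
    congr 1
    induction w using hSI.induction_left with
    | one =>
      rw [bar_std, invStd_one hSI hLI, parabolicIncl_std, bar_std, Subgroup.coe_one,
        invStd_one hS hL]
    | mul s hs w hlen ih =>
      rw [← genMul_std_of_lt (S := parabolicGens I) (L := (parabolicWeight L I)) (by omega),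
        parabolicIncl_genMul hS hI hs, bar_genMul hS hL (hI hs), ih (by simp),
        bar_genMul hSI hLI hs, genInv_apply, genInv_apply, map_sub, map_smul,
        parabolicIncl_genMul hS hI hs]
      rfl

theorem relMap_std {x : G} (hx : x ∈ minReps S I) (u : Subgroup.closure I) :
    relMap S L I x (stdBasis u) = stdBasis (x * u : G) := by
  rw [relMap_apply, parabolicIncl_std, heckeMul_std_apply_std hS hL (len_minRep_mul hS hI hx u)]

theorem relMap_eq_mapDomain {x : G} (hx : x ∈ minReps S I) (h : Hecke (Subgroup.closure I)) :
    relMap S L I x h = h.mapDomain fun u : Subgroup.closure I => x * u := by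
  have : relMap S L I x =
      Finsupp.lmapDomain LaurentA LaurentA (fun u : Subgroup.closure I => x * u) := by
    refine hecke_hom_ext fun u => ?_
    rw [relMap_std hS hL hI hx]
    simp
  rw [this]
  rfl

theorem relFamily_sub_std_coord_mem (p : minReps S I × Subgroup.closure I) (z : G) :
    (relFamily S I L p - stdBasis (p.1 * p.2 : G)) z ∈ negLaurent := by
  have hSI := isExchangeSystem_parabolicGens hS hI
  have hLI := isPositiveWeight_parabolicGens hS hI hL
  have h1 := (isKLElement_iff.1 (klBasis_spec hSI hLI p.2)).2
  have e : relFamily S I L p - stdBasis (p.1 * p.2 : G) =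
      (klBasis (parabolicGens I) (parabolicWeight L I) p.2 - stdBasis p.2).mapDomain
        fun u : Subgroup.closure I => (p.1 * u : G) := by
    rw [← relMap_eq_mapDomain hS hL hI p.1.2, map_sub, relMap_std hS hL hI p.1.2, relFamily]
  rw [e]
  by_cases hz : z ∈ Set.range fun u : Subgroup.closure I => (p.1 * u : G)
  · obtain ⟨u, rfl⟩ := hz
    rw [Finsupp.mapDomain_apply]
    · exact h1 u
    · exact fun u u' h => Subtype.ext (mul_left_cancel h)
  · rw [Finsupp.mapDomain_of_notMem_range _ _ hz]
    exact zero_mem _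

/-- The `T_x c_u` form a basis of the Hecke algebra, being unitriangular with respect to the
`T_{xu} = T_x T_u`. -/
def relB : Module.Basis (minReps S I × Subgroup.closure I) LaurentA (Hecke G) :=
  unitriangularBasis ((stdB G).reindex (cosetDecomp hS hI).symm) (c := relFamily S I L)
    (r := fun p q => p.1 = q.1 ∧ len S (p.2 : G) < len S (q.2 : G)) (ℓ := fun p => len S (p.2 : G))
    (fun _ _ h => h.2) (by
      have hSI := isExchangeSystem_parabolicGens hS hI
      have hLI := isPositiveWeight_parabolicGens hS hI hL
      rintro ⟨x, u⟩
      have h1 := klBasis_sub_mem hSI hLI u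
      have h2 := Submodule.mem_map_of_mem (f := relMap S L I (x : G)) h1
      rw [Submodule.map_span, map_sub, relMap_std hS hL hI x.2] at h2
      simp only [Module.Basis.reindex_apply, Equiv.symm_symm, cosetDecomp_apply, stdB_apply]
      refine Submodule.span_mono ?_ h2
      rintro _ ⟨_, ⟨v, hv, rfl⟩, rfl⟩
      refine ⟨(x, v), ⟨rfl, ?_⟩, by rw [relMap_std hS hL hI x.2]⟩
      simpa only [len_parabolic hS hI, Set.mem_ofPred_eq] using hv)

@[simp] theorem relB_apply (p : minReps S I × Subgroup.closure I) :
    relB hS hL hI p = relFamily S I L p := by simp [relB]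

theorem coe_relB : ⇑(relB hS hL hI) = relFamily S I L := funext (relB_apply hS hL hI)

omit hI in
theorem genMul_relFamily_of_lt {s : G} (hs : s ∈ S) {x : G} (hx : x ∈ minReps S I)
    (hsx : s * x ∈ minReps S I) (h : len S (s * x) = len S x + 1) (u : Subgroup.closure I) :
    genMul S L s (relFamily S I L (⟨x, hx⟩, u)) = relFamily S I L (⟨s * x, hsx⟩, u) := by
  rw [relFamily, relFamily, relMap_apply, relMap_apply, heckeMul_std_gen_mul hS hL hs h,
    Module.End.mul_apply]

/-- Multiplication by `T_s` raises the length of the coset representative by at most one and does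
not raise the index in the parabolic subgroup. -/
theorem genMul_relFamily_mem {s : G} (hs : s ∈ S) (x : minReps S I) (u : Subgroup.closure I) :
    genMul S L s (relFamily S I L (x, u)) ∈ Submodule.span LaurentA (relFamily S I L ''
      {p | len S (p.1 : G) ≤ len S (x : G) + 1 ∧
        LeftLE (parabolicGens I) (parabolicWeight L I) p.2 u}) := by
  have hSI := isExchangeSystem_parabolicGens hS hI
  have hLI := isPositiveWeight_parabolicGens hS hI hL
  obtain ⟨x, hx⟩ := x
  rcases gen_mul_minRep hS hI hs hx with hsx | ⟨t, ht, htx⟩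
  · rcases hS.len_gen_mul hs x with h | h
    · rw [genMul_relFamily_of_lt hS hL hs hx hsx h]
      exact Submodule.subset_span ⟨_, ⟨h.le, leftLE_refl _⟩, rfl⟩
    · have hssx : s * (s * x) ∈ minReps S I := by rwa [hS.mul_mul_cancel_left hs]
      have h1 := genMul_relFamily_of_lt hS hL hs hsx hssx
        (by rw [hS.mul_mul_cancel_left hs]; omega) u
      have e : (⟨s * (s * x), hssx⟩ : minReps S I) = ⟨x, hx⟩ :=
        Subtype.ext (hS.mul_mul_cancel_left hs x)
      rw [e] at h1
      have h2 := genMul_genMul (L := L) hS hs (relFamily S I L (⟨s * x, hsx⟩, u))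
      rw [h1] at h2
      rw [h2]
      refine add_mem (Submodule.subset_span ⟨_, ⟨?_, leftLE_refl _⟩, rfl⟩)
        (Submodule.smul_mem _ _ (Submodule.subset_span ⟨_, ⟨?_, leftLE_refl _⟩, rfl⟩))
      · show len S (s * x) ≤ len S x + 1
        omega
      · show len S x ≤ len S x + 1
        omega
  · -- Here `sx = xt` with `t ∈ I`, so `T_s T_x = T_x T_t` and `T_t` acts on `c_u`.
    have hlen := len_minRep_mul hS hI hx t
    rw [hS.len_gen (hI ht)] at hlen
    have e : genMul S L s * heckeMul S L (stdBasis x) =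
        heckeMul S L (stdBasis x) * genMul S L (t : G) := by
      rw [← heckeMul_std_gen_mul hS hL hs (by rw [htx, hlen]), htx,
        heckeMul_std_mul hS hL (by rw [hlen, hS.len_gen (hI ht)]), heckeMul_std_gen hS hL (hI ht)]
    have e2 : genMul S L s (relFamily S I L (⟨x, hx⟩, u)) = relMap S L I x
        (genMul (parabolicGens I) (parabolicWeight L I) t
          (klBasis (parabolicGens I) (parabolicWeight L I) u)) := by
      rw [relFamily, relMap_apply, relMap_apply, parabolicIncl_genMul hS hI ht,
        ← Module.End.mul_apply, e, Module.End.mul_apply]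
    rw [e2]
    have h1 := Submodule.mem_map_of_mem (f := relMap S L I x)
      (genMul_klBasis_mem hSI hLI ht u)
    rw [Submodule.map_span] at h1
    refine Submodule.span_mono ?_ h1
    rintro _ ⟨_, ⟨v, hv, rfl⟩, rfl⟩
    exact ⟨(⟨x, hx⟩, v), ⟨by simp, hv⟩, rfl⟩

theorem bar_relFamily_sub_mem (x : minReps S I) (u : Subgroup.closure I) :
    bar S L (relFamily S I L (x, u)) - relFamily S I L (x, u) ∈
      Submodule.span LaurentA (relFamily S I L ''
        {p | len S (p.1 : G) < len S (x : G) ∧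
          LeftLE (parabolicGens I) (parabolicWeight L I) p.2 u}) := by
  have hSI := isExchangeSystem_parabolicGens hS hI
  have hLI := isPositiveWeight_parabolicGens hS hI hL
  obtain ⟨x, hx⟩ := x
  induction x using hS.induction_left with
  | one =>
    have e : bar S L (relFamily S I L (⟨1, hx⟩, u)) = relFamily S I L (⟨1, hx⟩, u) := by
      rw [relFamily, relMap_apply, heckeMul_std_one hS hL, Module.End.one_apply]
      rw [bar_parabolicIncl hS hL hI, (isKLElement_iff.1 (klBasis_spec hSI hLI u)).1]
    rw [e, sub_self]
    exact zero_mem _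
  | mul s hs y hlen ih =>
    have hy := minRep_of_gen_mul hS hI hs hx hlen
    specialize ih hy
    rw [← genMul_relFamily_of_lt hS hL hs hy hx hlen, bar_genMul hS hL hs, genInv_apply]
    set d := relFamily S I L (⟨y, hy⟩, u) with hd
    have e : genMul S L s (bar S L d) - quadCoeff L s • bar S L d - genMul S L s d =
        genMul S L s (bar S L d - d) - quadCoeff L s • ((bar S L d - d) + d) := by
      rw [map_sub, sub_add_cancel]; abel
    rw [e]
    dsimp only at ih ⊢
    refine sub_mem ?_ (Submodule.smul_mem _ _ (add_mem ?_ ?_))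
    · have h1 := Submodule.mem_map_of_mem (f := genMul S L s) ih
      refine (Submodule.map_span_le _ _ _).2 ?_ h1
      rintro _ ⟨⟨z, v⟩, ⟨hz, hv⟩, rfl⟩
      refine Submodule.span_mono (Set.image_mono ?_) (genMul_relFamily_mem hS hL hI hs z v)
      rintro ⟨z', v'⟩ ⟨hz', hv'⟩
      dsimp only at hz hz' hv hv'
      exact ⟨by dsimp only; omega, leftLE_trans hv' hv⟩
    · refine Submodule.span_mono (Set.image_mono ?_) ih
      rintro ⟨z, v⟩ ⟨hz, hv⟩
      dsimp only at hz
      exact ⟨by dsimp only; omega, hv⟩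
    · exact Submodule.subset_span ⟨_, ⟨by dsimp only; omega, leftLE_refl _⟩, rfl⟩

/-- Geck's relative form of the Kazhdan–Lusztig basis: `c_{xu}` is `T_x c_u` plus a combination of
`T_y c_v` with `y` shorter than `x` and `v ≤ u` in the left preorder of the parabolic subgroup. -/
theorem klBasis_sub_relFamily_mem (x : minReps S I) (u : Subgroup.closure I) :
    klBasis S L (x * u : G) - relFamily S I L (x, u) ∈
      Submodule.span LaurentA (relFamily S I L ''
        {p | len S (p.1 : G) < len S (x : G) ∧
          LeftLE (parabolicGens I) (parabolicWeight L I) p.2 u}) := by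
  classical
  obtain ⟨c, h1, h2, h3⟩ := exists_bar_invariant (relB hS hL hI)
    (r := fun p q => len S (p.1 : G) < len S (q.1 : G) ∧
      LeftLE (parabolicGens I) (parabolicWeight L I) p.2 q.2)
    (ℓ := fun p => len S (p.1 : G)) (fun _ _ h => h.1) (β := barHom S L) bar_smul
    (fun p => by
      rw [coe_relB, barHom_apply]; exact bar_relFamily_sub_mem hS hL hI p.1 p.2)
    (fun _ _ _ h h' => ⟨h.1.trans h'.1, leftLE_trans h.2 h'.2⟩) (bar_bar hS hL) (x, u)
  rw [coe_relB] at h3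
  have h4 : IsKLElement S L (x * u : G) c := by
    refine isKLElement_iff.2 ⟨h1, fun z => ?_⟩
    have e1 : c - stdBasis (x * u : G) = (c - relB hS hL hI (x, u)) +
        (relFamily S I L (x, u) - stdBasis (x * u : G)) := by rw [relB_apply]; abel
    rw [e1, Finsupp.add_apply]
    refine add_mem ?_ (relFamily_sub_std_coord_mem hS hL hI (x, u) z)
    rw [← (relB hS hL hI).linearCombination_repr (c - relB hS hL hI (x, u)),
      Finsupp.linearCombination_apply, Finsupp.sum, Finsupp.finsetSum_apply]
    refine sum_mem fun p _ => ?_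
    have hp := h2 p
    have e2 : relB hS hL hI p = (relFamily S I L p - stdBasis (p.1 * p.2 : G)) +
        stdBasis (p.1 * p.2 : G) := by rw [relB_apply]; abel
    rw [Finsupp.smul_apply, smul_eq_mul, e2, Finsupp.add_apply, mul_add]
    refine add_mem (mul_mem_negLaurent hp (relFamily_sub_std_coord_mem hS hL hI p z)) ?_
    rw [Finsupp.single_apply]
    split_ifs
    · rwa [mul_one]
    · rw [mul_zero]; exact zero_mem _
  rw [klBasis_eq hS hL h4]
  exact h3

/-- The elements `c_{xu}` and the elements `T_x c_u`, with `u` below a given element, span the same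
submodule. -/
theorem span_klBasis_eq_span_relFamily (u : Subgroup.closure I) :
    Submodule.span LaurentA ((fun p : minReps S I × Subgroup.closure I =>
      klBasis S L (p.1 * p.2 : G)) '' {p | LeftLE (parabolicGens I) (parabolicWeight L I) p.2 u}) =
    Submodule.span LaurentA (relFamily S I L ''
      {p | LeftLE (parabolicGens I) (parabolicWeight L I) p.2 u}) := by
  rw [← coe_relB hS hL hI]
  exact span_image_unitriangular (relB hS hL hI)
    (r := fun p q => len S (p.1 : G) < len S (q.1 : G) ∧
      LeftLE (parabolicGens I) (parabolicWeight L I) p.2 q.2)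
    (ℓ := fun p => len S (p.1 : G)) (fun _ _ h => h.1)
    (fun p => by rw [coe_relB]; exact klBasis_sub_relFamily_mem hS hL hI p.1 p.2)
    (fun _ _ h h' => leftLE_trans h.2 h')

theorem klBasis_mem_span_relFamily (x : minReps S I) (u : Subgroup.closure I) :
    klBasis S L (x * u : G) ∈ Submodule.span LaurentA (relFamily S I L ''
      {p | LeftLE (parabolicGens I) (parabolicWeight L I) p.2 u}) := by
  rw [← span_klBasis_eq_span_relFamily hS hL hI]
  exact Submodule.subset_span ⟨(x, u), leftLE_refl u, rfl⟩

/-- The Kazhdan–Lusztig basis of a parabolic subgroup is part of that of the group. -/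
theorem klBasis_coe (u : Subgroup.closure I) :
    klBasis S L (u : G) = parabolicIncl I (klBasis (parabolicGens I) (parabolicWeight L I) u) := by
  have h1 := klBasis_sub_relFamily_mem hS hL hI ⟨1, one_mem_minReps⟩ u
  have e : {p : minReps S I × Subgroup.closure I | len S (p.1 : G) < len S (1 : G) ∧
      LeftLE (parabolicGens I) (parabolicWeight L I) p.2 u} = ∅ :=
    Set.eq_empty_iff_forall_notMem.2 fun p hp => by
      have := hp.1
      rw [len_one] at this
      exact absurd this (Nat.not_lt_zero _)
  rw [e, Set.image_empty, Submodule.span_empty, Submodule.mem_bot, sub_eq_zero, one_mul] at h1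
  rw [h1, relFamily, relMap_apply, heckeMul_std_one hS hL, Module.End.one_apply]

/-- The parabolic component of a group element with respect to the minimal coset
representatives. -/
def parabolicPart (w : G) : Subgroup.closure I := ((cosetDecomp hS hI).symm w).2

omit hL in
@[simp] theorem parabolicPart_mul (x : minReps S I) (u : Subgroup.closure I) :
    parabolicPart hS hI (x * u : G) = u := by
  rw [parabolicPart, ← cosetDecomp_apply hS hI (x, u), Equiv.symm_apply_apply]

/-- The left preorder projects to the left preorder of a parabolic subgroup. -/
theorem leftLE_parabolicPart {y w : G} (h : LeftLE S L y w) :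
    LeftLE (parabolicGens I) (parabolicWeight L I) (parabolicPart hS hI y)
      (parabolicPart hS hI w) := by
  refine rel_of_leftLE hS hL (r := fun y w => LeftLE (parabolicGens I) (parabolicWeight L I)
    (parabolicPart hS hI y) (parabolicPart hS hI w)) (fun _ => leftLE_refl _)
    (fun _ _ _ => leftLE_trans) ?_ h
  intro s hs w
  obtain ⟨⟨x, u⟩, rfl⟩ := (cosetDecomp hS hI).surjective w
  rw [cosetDecomp_apply, parabolicPart_mul]
  -- The two families span the same subspace, which is stable under `T_s`.
  have e : klBasis S L ''
      {y | LeftLE (parabolicGens I) (parabolicWeight L I) (parabolicPart hS hI y) u} =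
      (fun p : minReps S I × Subgroup.closure I => klBasis S L (p.1 * p.2 : G)) ''
        {p | LeftLE (parabolicGens I) (parabolicWeight L I) p.2 u} := by
    ext h
    constructor
    · rintro ⟨y, hy, rfl⟩
      obtain ⟨⟨x, v⟩, rfl⟩ := (cosetDecomp hS hI).surjective y
      refine ⟨(x, v), ?_, rfl⟩
      simpa using hy
    · rintro ⟨⟨x, v⟩, hv, rfl⟩
      exact ⟨x * v, by simpa using hv, rfl⟩
  rw [e, span_klBasis_eq_span_relFamily hS hL hI]
  refine (Submodule.map_span_le (genMul S L s) _ _).2 ?_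
    (Submodule.mem_map_of_mem (klBasis_mem_span_relFamily hS hL hI x u))
  rintro _ ⟨⟨z, v⟩, hv, rfl⟩
  refine Submodule.span_mono (Set.image_mono ?_) (genMul_relFamily_mem hS hL hI hs z v)
  rintro ⟨z', v'⟩ ⟨-, hv'⟩
  exact leftLE_trans hv' hv

end Relative

/-! ### Representations triangular with respect to a preorder -/

theorem nonempty_equiv_of_bijective {V V' : Type*} [AddCommMonoid V] [Module ℂ V]
    [AddCommMonoid V'] [Module ℂ V'] {ρ : Representation ℂ G V} {σ : Representation ℂ G V'}
    (P : V →ₗ[ℂ] V') (hP : Function.Bijective P) (hcomm : ∀ g f, P (ρ g f) = σ g (P f)) :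
    Nonempty (ρ.Equiv σ) :=
  ⟨Representation.Equiv.mk (LinearEquiv.ofBijective P hP) fun g => LinearMap.ext fun f =>
    hcomm g f⟩

section Triangular

variable {ι : Type*} (R : Representation ℂ G (ι →₀ ℂ)) (r : ι → ι → Prop)

/-- The representation maps a basis vector into the span of the basis vectors below it. -/
def IsTriangularRep : Prop := ∀ (g : G) (y z : ι), R g (Finsupp.single y 1) z ≠ 0 → r z y

/-- The set is convex with respect to the relation. -/
def IsConvexFor (C : Set ι) : Prop := ∀ x y z, x ∈ C → z ∈ C → r x y → r y z → y ∈ C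

/-- The extension by zero of coordinates. -/
def extendCoord (C : Set ι) : (C →₀ ℂ) →ₗ[ℂ] (ι →₀ ℂ) := Finsupp.lmapDomain ℂ ℂ Subtype.val

/-- The restriction of coordinates. -/
def restrictCoord (C : Set ι) : (ι →₀ ℂ) →ₗ[ℂ] (C →₀ ℂ) := Finsupp.lsubtypeDomain C

@[simp] theorem extendCoord_single {C : Set ι} (y : C) (a : ℂ) :
    extendCoord C (Finsupp.single y a) = Finsupp.single (y : ι) a := by
  simp [extendCoord]

@[simp] theorem restrictCoord_apply {C : Set ι} (f : ι →₀ ℂ) (y : C) :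
    restrictCoord C f y = f y := rfl

theorem restrictCoord_extendCoord {C : Set ι} (f : C →₀ ℂ) :
    restrictCoord C (extendCoord C f) = f := by
  ext y
  rw [restrictCoord_apply, extendCoord, Finsupp.lmapDomain_apply,
    Finsupp.mapDomain_apply Subtype.val_injective]

theorem restrictCoord_single_of_mem {C : Set ι} {z : ι} (hz : z ∈ C) (a : ℂ) :
    restrictCoord C (Finsupp.single z a) = Finsupp.single ⟨z, hz⟩ a := by
  rw [← restrictCoord_extendCoord (Finsupp.single (⟨z, hz⟩ : C) a), extendCoord_single]

theorem restrictCoord_single_of_notMem {C : Set ι} {z : ι} (hz : z ∉ C) (a : ℂ) :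
    restrictCoord C (Finsupp.single z a) = 0 := by
  ext y
  rw [restrictCoord_apply, Finsupp.single_eq_of_ne]
  · rfl
  · rintro rfl
    exact hz y.2

theorem extendCoord_apply_of_notMem {C : Set ι} (f : C →₀ ℂ) {z : ι} (hz : z ∉ C) :
    extendCoord C f z = 0 := by
  rw [extendCoord, Finsupp.lmapDomain_apply, Finsupp.mapDomain_of_notMem_range]
  simpa using hz

variable {R r} (hR : IsTriangularRep R r)
include hR

/-- Vectors outside a convex set but below an element of it contribute nothing to the action. -/
theorem restrictCoord_eq_zero {C : Set ι} {f : ι →₀ ℂ} (g : G)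
    (hf : ∀ z, f z ≠ 0 → ∀ c ∈ C, ¬ r c z) : restrictCoord C (R g f) = 0 := by
  ext c
  rw [restrictCoord_apply]
  conv_lhs => rw [← f.sum_single]
  simp only [Finsupp.sum, map_sum, Finsupp.finsetSum_apply, Finsupp.coe_zero, Pi.zero_apply]
  refine Finset.sum_eq_zero fun z hz => ?_
  rw [← mul_one (f z), ← smul_eq_mul, ← Finsupp.smul_single, map_smul, Finsupp.smul_apply]
  by_contra h
  exact hf z (Finsupp.mem_support_iff.1 hz) c c.2 (hR g z c (right_ne_zero_of_smul h))

theorem restrictCoord_extend_restrict {C : Set ι} (hC : IsConvexFor r C) (g h : G) (y : C) :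
    restrictCoord C (R g (extendCoord C (restrictCoord C (R h (Finsupp.single (y : ι) 1))))) =
      restrictCoord C (R g (R h (Finsupp.single (y : ι) 1))) := by
  set f := R h (Finsupp.single (y : ι) 1) with hf
  rw [← sub_eq_zero, ← map_sub, ← map_sub]
  refine restrictCoord_eq_zero hR g fun z hz c hc hcz => ?_
  rw [Finsupp.sub_apply] at hz
  by_cases hzC : z ∈ C
  · refine hz ?_
    have := DFunLike.congr_fun (restrictCoord_extendCoord (restrictCoord C f)) ⟨z, hzC⟩
    rw [restrictCoord_apply, restrictCoord_apply] at this
    rw [this, sub_self]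
  · rw [extendCoord_apply_of_notMem _ hzC, zero_sub, neg_ne_zero] at hz
    exact hzC (hC c z y hc y.2 hcz (hR h y z hz))

/-- The subquotient of a triangular representation with basis a convex set. -/
def subquotient {C : Set ι} (hC : IsConvexFor r C) : Representation ℂ G (C →₀ ℂ) where
  toFun g := restrictCoord C ∘ₗ R g ∘ₗ extendCoord C
  map_one' := by
    refine LinearMap.ext fun f => ?_
    simp [restrictCoord_extendCoord]
  map_mul' g h := by
    refine Finsupp.lhom_ext' fun y => LinearMap.ext_ring ?_
    simp only [LinearMap.comp_apply, Finsupp.lsingle_apply, extendCoord_single,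
      Module.End.mul_apply, restrictCoord_extend_restrict hR hC, map_mul]

theorem subquotient_apply {C : Set ι} (hC : IsConvexFor r C) (g : G) (f : C →₀ ℂ) :
    subquotient hR hC g f = restrictCoord C (R g (extendCoord C f)) := rfl

theorem subquotient_single {C : Set ι} (hC : IsConvexFor r C) (g : G) (y : C) :
    subquotient hR hC g (Finsupp.single y 1) =
      restrictCoord C (R g (Finsupp.single (y : ι) 1)) := by
  rw [subquotient_apply, extendCoord_single]

theorem subquotient_asAlgebraHom {C : Set ι} (hC : IsConvexFor r C) (a : ℂ[G]) (f : C →₀ ℂ) :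
    (subquotient hR hC).asAlgebraHom a f =
      restrictCoord C (R.asAlgebraHom a (extendCoord C f)) := by
  induction a using MonoidAlgebra.induction_linear with
  | zero => simp
  | add a b ha hb => simp only [map_add, LinearMap.add_apply, ha, hb]
  | single g a =>
    rw [Representation.asAlgebraHom_single, Representation.asAlgebraHom_single,
      LinearMap.smul_apply, LinearMap.smul_apply, map_smul, subquotient_apply]

theorem restrict_extend_subquotient_single {C D : Set ι} (hC : IsConvexFor r C) (hD : D ⊆ C)
    (g : G) (y : C) : restrictCoord D (extendCoord C (subquotient hR hC g (Finsupp.single y 1))) =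
      restrictCoord D (R g (Finsupp.single (y : ι) 1)) := by
  ext z
  rw [subquotient_single, restrictCoord_apply, restrictCoord_apply]
  have := DFunLike.congr_fun (restrictCoord_extendCoord
    (restrictCoord C (R g (Finsupp.single (y : ι) 1)))) ⟨z, hD z.2⟩
  rwa [restrictCoord_apply, restrictCoord_apply] at this

variable [Finite G]

/-- The average over the group of the projection from one subquotient to a smaller one. -/
def averageProj {C D : Set ι} (hC : IsConvexFor r C) (hD : IsConvexFor r D) :
    (C →₀ ℂ) →ₗ[ℂ] (D →₀ ℂ) :=
  ((Nat.card G : ℂ)⁻¹) • ∑ᶠ g : G, subquotient hR hD g ∘ₗ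
    (restrictCoord D ∘ₗ extendCoord C) ∘ₗ subquotient hR hC g⁻¹

omit [Finite G] in
theorem averageProj_apply {C D : Set ι} (hC : IsConvexFor r C) (hD : IsConvexFor r D)
    [Fintype G] (f : C →₀ ℂ) : averageProj hR hC hD f = ((Nat.card G : ℂ)⁻¹) • ∑ g : G,
      subquotient hR hD g (restrictCoord D (extendCoord C (subquotient hR hC g⁻¹ f))) := by
  rw [averageProj, finsum_eq_sum_of_fintype]
  simp

theorem averageProj_comm {C D : Set ι} (hC : IsConvexFor r C) (hD : IsConvexFor r D) (h : G)
    (f : C →₀ ℂ) : averageProj hR hC hD (subquotient hR hC h f) =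
      subquotient hR hD h (averageProj hR hC hD f) := by
  have := Fintype.ofFinite G
  rw [averageProj_apply, averageProj_apply, map_smul, map_sum]
  congr 1
  refine Fintype.sum_equiv (Equiv.mulLeft h⁻¹) _ _ fun g => ?_
  rw [Equiv.coe_mulLeft, ← Module.End.mul_apply, ← map_mul, ← Module.End.mul_apply, ← map_mul]
  simp

theorem averageProj_single_of_mem {C D : Set ι} (hC : IsConvexFor r C) (hD : IsConvexFor r D)
    (hDC : D ⊆ C) (y : C) (hy : (y : ι) ∈ D) :
    averageProj hR hC hD (Finsupp.single y 1) = Finsupp.single ⟨y, hy⟩ 1 := by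
  have := Fintype.ofFinite G
  rw [averageProj_apply]
  have e : ∀ g : G, subquotient hR hD g (restrictCoord D (extendCoord C
      (subquotient hR hC g⁻¹ (Finsupp.single y 1)))) = Finsupp.single ⟨y, hy⟩ 1 := by
    intro g
    rw [restrict_extend_subquotient_single hR hC hDC,
      ← subquotient_single hR hD g⁻¹ ⟨y, hy⟩, Representation.self_inv_apply]
  rw [Finset.sum_congr rfl fun g _ => e g, Finset.sum_const, Finset.card_univ,
    ← Nat.card_eq_fintype_card, ← Nat.cast_smul_eq_nsmul ℂ, smul_smul, inv_mul_cancel₀, one_smul]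
  exact Nat.cast_ne_zero.2 Nat.card_pos.ne'

theorem exists_rel_of_averageProj_ne_zero {C D : Set ι} (hC : IsConvexFor r C)
    (hD : IsConvexFor r D) (hDC : D ⊆ C) (y : C) (z : D)
    (h : averageProj hR hC hD (Finsupp.single y 1) z ≠ 0) : ∃ w ∈ D, r z w ∧ r w y := by
  have := Fintype.ofFinite G
  rw [averageProj_apply, Finsupp.smul_apply, Finsupp.finsetSum_apply] at h
  obtain ⟨g, -, hg⟩ := Finset.exists_ne_zero_of_sum_ne_zero (right_ne_zero_of_smul h)
  rw [restrict_extend_subquotient_single hR hC hDC, subquotient_apply] at hg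
  by_contra hcon
  push Not at hcon
  rw [restrictCoord_apply] at hg
  set q := extendCoord D (restrictCoord D (R g⁻¹ (Finsupp.single (y : ι) 1))) with hq
  have h0 : restrictCoord {(z : ι)} (R g q) = 0 := by
    refine restrictCoord_eq_zero hR g fun w hw c hc hcw => ?_
    obtain rfl : c = z := hc
    have hwD : w ∈ D := by
      by_contra hwD
      exact hw (extendCoord_apply_of_notMem _ hwD)
    have e := DFunLike.congr_fun (restrictCoord_extendCoord
      (restrictCoord D (R g⁻¹ (Finsupp.single (y : ι) 1)))) ⟨w, hwD⟩
    rw [restrictCoord_apply, restrictCoord_apply] at e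
    rw [hq, e] at hw
    exact hcon w hwD hcw (hR _ _ _ hw)
  exact hg (DFunLike.congr_fun h0 ⟨z, rfl⟩)

omit hR in
theorem isConvexFor_class (htrans : ∀ x y z, r x y → r y z → r x z) (w : ι) :
    IsConvexFor r {y | r y w ∧ r w y} := fun _ _ _ hx hz hxy hyz =>
  ⟨htrans _ _ _ hyz hz.1, htrans _ _ _ hx.2 hxy⟩

/-- A triangular representation is the direct sum of its subquotients with respect to the
equivalence classes of the preorder. The averaged projections to the subquotients are together
unitriangular, hence an isomorphism. -/
theorem nonempty_equiv_directSum [Finite ι] (hrefl : ∀ x, r x x)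
    (htrans : ∀ x y z, r x y → r y z → r x z)
    {C : Set ι} (hC : IsConvexFor r C) {κ : Type*} [Fintype κ] (Γ : κ → Set ι)
    (hinj : Function.Injective Γ) (hcell : ∀ i, ∃ w, Γ i = {y | r y w ∧ r w y})
    (hΓ : ∀ i, IsConvexFor r (Γ i)) (hsub : ∀ i, Γ i ⊆ C) (hcov : ∀ y ∈ C, ∃ i, y ∈ Γ i) :
    Nonempty ((subquotient hR hC).Equiv
      (Representation.directSum fun i => subquotient hR (hΓ i))) := by
  classical
  have hmem : ∀ {i y z}, y ∈ Γ i → (z ∈ Γ i ↔ r z y ∧ r y z) := by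
    intro i y z hy
    obtain ⟨w, hw⟩ := hcell i
    rw [hw] at hy ⊢
    exact ⟨fun hz => ⟨htrans _ _ _ hz.1 hy.2, htrans _ _ _ hy.1 hz.2⟩,
      fun hz => ⟨htrans _ _ _ hz.1 hy.1, htrans _ _ _ hy.2 hz.2⟩⟩
  have hdisj : ∀ {i j y}, y ∈ Γ i → y ∈ Γ j → i = j := by
    intro i j y hi hj
    exact hinj (Set.ext fun z => (hmem hi).trans (hmem hj).symm)
  let P : (C →₀ ℂ) →ₗ[ℂ] DirectSum κ fun i => (Γ i →₀ ℂ) :=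
    ∑ i, DirectSum.lof ℂ κ (fun i => (Γ i →₀ ℂ)) i ∘ₗ averageProj hR hC (hΓ i)
  have hP : ∀ f i, P f i = averageProj hR hC (hΓ i) f := by
    intro f i
    simp only [P, LinearMap.sum_apply, LinearMap.comp_apply]
    rw [DFinsupp.finsetSum_apply, Finset.sum_eq_single i]
    · exact DirectSum.lof_apply _ _ _
    · intro j _ hj
      exact DirectSum.of_eq_of_ne _ _ _ hj.symm
    · simp
  have hPinj : Function.Injective P := by
    rw [injective_iff_map_eq_zero]
    intro f hf
    by_contra hne
    let ℓ : C → ℕ := fun y => {z : ι | r z y}.ncard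
    obtain ⟨y, hy, hmax⟩ := Finset.exists_max_image f.support ℓ (Finsupp.support_nonempty_iff.2 hne)
    obtain ⟨i, hi⟩ := hcov y y.2
    have h1 : averageProj hR hC (hΓ i) f ⟨y, hi⟩ = 0 := by rw [← hP, hf]; rfl
    rw [← f.sum_single, Finsupp.sum, map_sum, Finsupp.finsetSum_apply,
      Finset.sum_eq_single_of_mem y hy] at h1
    · rw [← mul_one (f y), ← smul_eq_mul, ← Finsupp.smul_single, map_smul, Finsupp.smul_apply,
        averageProj_single_of_mem hR hC (hΓ i) (hsub i) y hi, Finsupp.single_eq_same, smul_eq_mul,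
        mul_one] at h1
      exact Finsupp.mem_support_iff.1 hy h1
    · intro z hz hzy
      rw [← mul_one (f z), ← smul_eq_mul, ← Finsupp.smul_single, map_smul, Finsupp.smul_apply]
      by_contra hcon
      have h2 := right_ne_zero_of_smul hcon
      by_cases hzi : (z : ι) ∈ Γ i
      · rw [averageProj_single_of_mem hR hC (hΓ i) (hsub i) z hzi,
          Finsupp.single_eq_of_ne] at h2
        · exact h2 rfl
        · intro h
          exact hzy (Subtype.ext (congrArg Subtype.val h).symm)
      · -- The coefficient at `y` is nonzero only if `y` is strictly below `z`.
        obtain ⟨w, hw, hyw, hwz⟩ := exists_rel_of_averageProj_ne_zero hR hC (hΓ i) (hsub i) z _ h2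
        have hyz : r y z := htrans _ _ _ hyw hwz
        have hzy' : ¬ r z y := fun h => hzi ((hmem hi).2 ⟨h, hyz⟩)
        refine (hmax z hz).not_gt (Set.ncard_lt_ncard ?_ (Set.toFinite _))
        exact ⟨fun x hx => htrans _ _ _ hx hyz, fun h => hzy' (h (hrefl z))⟩
  have hfin : Module.finrank ℂ (C →₀ ℂ) =
      Module.finrank ℂ (DirectSum κ fun i => (Γ i →₀ ℂ)) := by
    have := Fintype.ofFinite C
    have := fun i => Fintype.ofFinite (Γ i)
    rw [Module.finrank_directSum]
    simp only [Module.finrank_finsupp_self]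
    rw [← Fintype.card_sigma]
    refine (Fintype.card_congr (Equiv.ofBijective
      (fun p : Σ i, Γ i => (⟨p.2, hsub p.1 p.2.2⟩ : C)) ⟨?_, ?_⟩)).symm
    · rintro ⟨i, y, hy⟩ ⟨j, z, hz⟩ h
      obtain rfl : y = z := congrArg Subtype.val h
      obtain rfl := hdisj hy hz
      rfl
    · rintro ⟨y, hy⟩
      obtain ⟨i, hi⟩ := hcov y hy
      exact ⟨⟨i, y, hi⟩, rfl⟩
  have hPsurj : Function.Surjective P :=
    letI := Module.addCommMonoidToAddCommGroup ℂ (M := DirectSum κ fun i => (Γ i →₀ ℂ))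
    (LinearMap.injective_iff_surjective_of_finrank_eq_finrank (f := P) hfin).1 hPinj
  refine nonempty_equiv_of_bijective P ⟨hPinj, hPsurj⟩ ?_
  intro g f
  refine DFinsupp.ext fun i => ?_
  rw [hP, averageProj_comm, ← hP f i]
  rfl

end Triangular

/-! ### Specialisation at `v = 1` -/

section Specialisation

@[simp] theorem specOne_T (n : ℤ) : specOne (LaurentPolynomial.T n) = 1 := by
  simp [specOne]

omit [Group G] in
theorem specHecke_coeff (h : Hecke G) (w : G) : (specHecke h).coeff w = specOne (h w) := rfl

theorem specHecke_add (h h' : Hecke G) : specHecke (h + h') = specHecke h + specHecke h' := by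
  ext w
  rw [MonoidAlgebra.coeff_add, Finsupp.add_apply]
  simp only [specHecke_coeff, Finsupp.add_apply, map_add]

theorem specHecke_zero : specHecke (0 : Hecke G) = 0 := by
  ext w
  simp [specHecke_coeff]

theorem specHecke_smul (a : LaurentA) (h : Hecke G) :
    specHecke (a • h) = specOne a • specHecke h := by
  ext w
  rw [MonoidAlgebra.coeff_smul, Finsupp.smul_apply]
  simp only [specHecke_coeff, Finsupp.smul_apply, smul_eq_mul, map_mul]

theorem specHecke_sub (h h' : Hecke G) : specHecke (h - h') = specHecke h - specHecke h' := by
  rw [eq_sub_iff_add_eq, ← specHecke_add, sub_add_cancel]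

omit [Group G] in
theorem specHecke_std (w : G) : specHecke (stdBasis w) = MonoidAlgebra.single w 1 := by
  simp [specHecke]

theorem specHecke_linearCombination {κ : Type*} (F : κ → Hecke G) (q : κ →₀ LaurentA) :
    specHecke (Finsupp.linearCombination LaurentA F q) =
      Finsupp.linearCombination ℂ (fun k => specHecke (F k))
        (q.mapRange specOne (map_zero specOne)) := by
  induction q using Finsupp.induction_linear with
  | zero => simp [specHecke_zero]
  | add p q hp hq =>
    rw [map_add, specHecke_add, hp, hq, Finsupp.mapRange_add (map_add specOne), map_add]
  | single k a => simp [specHecke_smul]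

theorem specHecke_mem_span {κ : Type*} {F : κ → Hecke G} {D : Set κ} {h : Hecke G}
    (hh : h ∈ Submodule.span LaurentA (F '' D)) :
    specHecke h ∈ Submodule.span ℂ ((fun k => specHecke (F k)) '' D) := by
  induction hh using Submodule.span_induction with
  | zero => rw [specHecke_zero]; exact zero_mem _
  | add x y _ _ hx hy => rw [specHecke_add]; exact add_mem hx hy
  | smul a x _ hx => rw [specHecke_smul]; exact Submodule.smul_mem _ _ hx
  | mem x hx =>
    obtain ⟨k, hk, rfl⟩ := hx
    exact Submodule.subset_span ⟨k, hk, rfl⟩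

variable {S : Set G} {L : G → ℤ}

theorem specHecke_genMul (s : G) (h : Hecke G) :
    specHecke (genMul S L s h) = MonoidAlgebra.single s 1 * specHecke h := by
  induction h using Finsupp.induction_linear with
  | zero => rw [map_zero, specHecke_zero, mul_zero]
  | add h h' ih ih' => rw [map_add, specHecke_add, ih, ih', specHecke_add, mul_add]
  | single w a =>
    have e : (Finsupp.single w a : Hecke G) = a • stdBasis w := by simp
    rw [e, map_smul, specHecke_smul, specHecke_smul, specHecke_std, mul_smul_comm,
      MonoidAlgebra.single_mul_single, one_mul]
    congr 1
    simp only [genMul, Finsupp.linearCombination_single, one_smul]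
    split_ifs
    · rw [specHecke_std]
    · rw [specHecke_add, specHecke_smul, map_sub, specOne_T, specOne_T, sub_self, zero_smul,
        add_zero, specHecke_std]

theorem specHecke_genInv (s : G) (h : Hecke G) :
    specHecke (genInv S L s h) = MonoidAlgebra.single s 1 * specHecke h := by
  rw [genInv_apply, specHecke_sub, specHecke_smul, quadCoeff, map_sub, specOne_T, specOne_T,
    sub_self, zero_smul, sub_zero, specHecke_genMul]

variable (hS : IsExchangeSystem S)
include hS

theorem specHecke_heckeMul (h h' : Hecke G) :
    specHecke (heckeMul S L h h') = specHecke h * specHecke h' := by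
  induction h using Finsupp.induction_linear with
  | zero => simp only [map_zero, LinearMap.zero_apply, specHecke_zero, zero_mul]
  | add h k ih ih' =>
    rw [map_add, LinearMap.add_apply, specHecke_add, ih, ih', specHecke_add, add_mul]
  | single w a =>
    have e : (Finsupp.single w a : Hecke G) = a • stdBasis w := by simp
    rw [e, map_smul, LinearMap.smul_apply, specHecke_smul, specHecke_smul, smul_mul_assoc,
      specHecke_std]
    congr 1
    simp only [heckeMul, Finsupp.linearCombination_single, one_smul]
    obtain ⟨-, hw, -⟩ := hS.reducedWord_spec w
    have key : ∀ l : List G, specHecke ((l.map (genMul S L)).prod h') =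
        MonoidAlgebra.single l.prod 1 * specHecke h' := by
      intro l
      induction l with
      | nil => simp [← MonoidAlgebra.one_def]
      | cons s l ih =>
        rw [List.map_cons, List.prod_cons, Module.End.mul_apply, specHecke_genMul, ih, ← mul_assoc,
          MonoidAlgebra.single_mul_single, one_mul, List.prod_cons]
    rw [key, hw]

/-- The linear automorphism `w ↦ (-1)^{ℓ(w)} w` of the group algebra. -/
def signTwist (S : Set G) : ℂ[G] →ₗ[ℂ] ℂ[G] :=
  Finsupp.linearCombination ℂ (fun w => MonoidAlgebra.single w ((-1) ^ len S w)) ∘ₗ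
    (MonoidAlgebra.coeffLinearEquiv ℂ).toLinearMap

omit hS in
theorem signTwist_single (w : G) (a : ℂ) :
    signTwist S (MonoidAlgebra.single w a) = MonoidAlgebra.single w (a * (-1) ^ len S w) := by
  simp [signTwist]

omit hS in
theorem signTwist_signTwist (a : ℂ[G]) : signTwist S (signTwist S a) = a := by
  induction a using MonoidAlgebra.induction_linear with
  | zero => simp
  | add a b ha hb => rw [map_add, map_add, ha, hb]
  | single w a =>
    rw [signTwist_single, signTwist_single, mul_assoc, ← mul_pow]
    simp

theorem neg_one_pow_len_mul_complex (a b : G) :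
    (-1 : ℂ) ^ len S (a * b) = (-1) ^ len S a * (-1) ^ len S b := by
  have := congrArg (fun u : ℤˣ => ((u : ℤ) : ℂ)) (hS.neg_one_pow_len_mul a b)
  simpa using this

variable (hL : IsPositiveWeight S L)
include hL

theorem specHecke_invStd (w : G) : specHecke (invStd S L w) = MonoidAlgebra.single w 1 := by
  induction w using hS.induction_left with
  | one => rw [invStd_one hS hL, specHecke_std]
  | mul s hs w hlen ih =>
    rw [invStd_gen_mul hS hL hs hlen, specHecke_genInv, ih, MonoidAlgebra.single_mul_single,
      one_mul]

theorem specHecke_dagger (h : Hecke G) :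
    specHecke (dagger S L h) = signTwist S (specHecke h) := by
  induction h using Finsupp.induction_linear with
  | zero => simp only [map_zero, specHecke_zero]
  | add h h' ih ih' => rw [map_add, specHecke_add, ih, ih', specHecke_add, map_add]
  | single w a =>
    have e : (Finsupp.single w a : Hecke G) = a • stdBasis w := by simp
    rw [e, map_smul, specHecke_smul, specHecke_smul, map_smul, specHecke_std, signTwist_single,
      dagger, Finsupp.linearCombination_single, one_smul, specHecke_smul, specHecke_invStd hS hL]
    simp

/-! ### Left cell representations -/

/-- The specialised Kazhdan–Lusztig basis of the group algebra. -/
def specB : Module.Basis G ℂ ℂ[G] :=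
  unitriangularBasis (Module.Basis.ofRepr (MonoidAlgebra.coeffLinearEquiv ℂ))
    (c := fun w => specHecke (klBasis S L w))
    (r := fun y w => len S y < len S w) (ℓ := len S) (fun _ _ h => h) (fun w => by
      have h1 := specHecke_mem_span (klBasis_sub_mem hS hL w)
      rw [specHecke_sub] at h1
      have e : ∀ w : G, (Module.Basis.ofRepr (MonoidAlgebra.coeffLinearEquiv ℂ :
          ℂ[G] ≃ₗ[ℂ] G →₀ ℂ)) w = specHecke (stdBasis w) := fun w => by
        rw [specHecke_std]; rfl
      rw [e, funext e]
      exact h1)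

@[simp] theorem specB_apply (w : G) : specB hS hL w = specHecke (klBasis S L w) := by
  simp [specB]

theorem specB_repr_specHecke (h : Hecke G) : (specB hS hL).repr (specHecke h) =
    (klCoord S L h).mapRange specOne (map_zero specOne) := by
  conv_lhs => rw [← (klB hS hL).linearCombination_repr h, specHecke_linearCombination]
  have e : (fun w => specHecke (klB hS hL w)) = specB hS hL := by
    funext w
    rw [klB_apply, specB_apply]
  rw [e, Module.Basis.repr_linearCombination, klCoord_eq hS hL]

/-- The left regular representation tensored with the sign character, in coordinates with respect
to the specialised Kazhdan–Lusztig basis. -/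
def klRep : Representation ℂ G (G →₀ ℂ) where
  toFun g := (-1 : ℂ) ^ len S g • ((specB hS hL).repr.toLinearMap ∘ₗ
    LinearMap.mulLeft ℂ (MonoidAlgebra.single g 1) ∘ₗ (specB hS hL).repr.symm.toLinearMap)
  map_one' := by
    refine LinearMap.ext fun f => ?_
    simp [len_one, ← MonoidAlgebra.one_def]
  map_mul' g h := by
    refine LinearMap.ext fun f => ?_
    have e : (MonoidAlgebra.single (g * h) 1 : ℂ[G]) =
        MonoidAlgebra.single g 1 * MonoidAlgebra.single h 1 := by
      rw [MonoidAlgebra.single_mul_single, one_mul]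
    simp only [LinearMap.smul_apply, LinearMap.comp_apply, LinearEquiv.coe_coe,
      LinearMap.mulLeft_apply, Module.End.mul_apply, map_smul, LinearEquiv.symm_apply_apply]
    rw [smul_smul, neg_one_pow_len_mul_complex hS, e, mul_assoc, mul_comm ((-1 : ℂ) ^ len S h)]

theorem klRep_apply (g : G) (f : G →₀ ℂ) : klRep hS hL g f = (-1 : ℂ) ^ len S g •
    (specB hS hL).repr (MonoidAlgebra.single g 1 * (specB hS hL).repr.symm f) := rfl

theorem klRep_single (g w : G) : klRep hS hL g (Finsupp.single w 1) = (-1 : ℂ) ^ len S g •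
    (specB hS hL).repr (MonoidAlgebra.single g 1 * specHecke (klBasis S L w)) := by
  rw [klRep_apply, Module.Basis.repr_symm_single_one, specB_apply]

theorem klRep_asAlgebraHom (a : ℂ[G]) (f : G →₀ ℂ) :
    (klRep hS hL).asAlgebraHom (signTwist S a) f =
      (specB hS hL).repr (a * (specB hS hL).repr.symm f) := by
  induction a using MonoidAlgebra.induction_linear with
  | zero => simp
  | add a b ha hb => rw [map_add, map_add, LinearMap.add_apply, ha, hb, add_mul, map_add]
  | single w a =>
    have e : (MonoidAlgebra.single w a : ℂ[G]) = a • MonoidAlgebra.single w 1 := by simp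
    have h1 : (-1 : ℂ) ^ len S w * (-1) ^ len S w = 1 := by rw [← mul_pow]; simp
    rw [signTwist_single, Representation.asAlgebraHom_single, LinearMap.smul_apply, klRep_apply,
      smul_smul, mul_assoc, h1, mul_one, e, smul_mul_assoc, map_smul]

theorem isTriangularRep_klRep : IsTriangularRep (klRep hS hL) (LeftLE S L) := by
  intro g y z hz
  have key : MonoidAlgebra.single g 1 * specHecke (klBasis S L y) ∈
      Submodule.span ℂ ((fun w => specHecke (klBasis S L w)) '' {z | LeftLE S L z y}) := by
    clear hz
    induction g using hS.induction_left with
    | one =>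
      rw [← MonoidAlgebra.one_def, one_mul]
      exact Submodule.subset_span ⟨y, leftLE_refl y, rfl⟩
    | mul s hs w hlen ih =>
      rw [← one_mul (1 : ℂ), ← MonoidAlgebra.single_mul_single, mul_assoc]
      refine (Submodule.map_span_le (LinearMap.mulLeft ℂ (MonoidAlgebra.single s 1)) _ _).2 ?_
        (Submodule.mem_map_of_mem ih)
      rintro _ ⟨x, hx, rfl⟩
      rw [LinearMap.mulLeft_apply, ← specHecke_genMul (S := S) (L := L)]
      refine Submodule.span_mono (Set.image_mono ?_)
        (specHecke_mem_span (genMul_klBasis_mem hS hL hs x))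
      exact fun u hu => leftLE_trans hu hx
  have e : (fun w => specHecke (klBasis S L w)) = specB hS hL := by
    funext w
    rw [specB_apply]
  rw [e, (specB hS hL).mem_span_image] at key
  rw [klRep_single, Finsupp.smul_apply] at hz
  exact key (Finsupp.mem_support_iff.2 (right_ne_zero_of_smul hz))

omit hS hL in
theorem isConvexFor_leftCell {Γ : Set G} (hΓ : IsLeftCell S L Γ) :
    IsConvexFor (LeftLE S L) Γ := by
  obtain ⟨w, rfl⟩ := hΓ
  exact isConvexFor_class (fun _ _ _ => leftLE_trans) w

theorem isLeftCellRep_subquotient {Γ : Set G} (hΓ : IsConvexFor (LeftLE S L) Γ) :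
    IsLeftCellRep S L Γ (subquotient (isTriangularRep_klRep hS hL) hΓ) := by
  intro x y
  rw [subquotient_asAlgebraHom, extendCoord_single, specHecke_dagger hS hL, klRep_asAlgebraHom,
    Module.Basis.repr_symm_single_one, specB_apply, ← specHecke_heckeMul (L := L) hS,
    specB_repr_specHecke hS hL]
  exact Finsupp.ext fun z => rfl

/-- A left cell representation is determined by its defining property, because the elements `c_x†`
span the group algebra after specialisation. -/
theorem isLeftCellRep_unique {Γ : Set G} {ρ ρ' : Representation ℂ G (Γ →₀ ℂ)}
    (h : IsLeftCellRep S L Γ ρ) (h' : IsLeftCellRep S L Γ ρ') : ρ = ρ' := by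
  have e : ρ.asAlgebraHom.toLinearMap ∘ₗ signTwist S =
      ρ'.asAlgebraHom.toLinearMap ∘ₗ signTwist S := by
    refine (specB hS hL).ext fun x => Finsupp.lhom_ext' fun y => LinearMap.ext_ring ?_
    simp only [LinearMap.comp_apply, specB_apply, AlgHom.toLinearMap_apply,
      Finsupp.lsingle_apply, ← specHecke_dagger hS hL]
    rw [h x y, h' x y]
  refine MonoidHom.ext fun g => ?_
  have h1 := LinearMap.congr_fun e (signTwist S (MonoidAlgebra.single g 1))
  simpa only [LinearMap.comp_apply, signTwist_signTwist, AlgHom.toLinearMap_apply,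
    Representation.asAlgebraHom_single_one] using h1

end Specialisation

/-! ### Induction of left cell representations -/

section Induction

variable {H V V' : Type*} [Group H] [AddCommGroup V] [Module ℂ V] [AddCommGroup V'] [Module ℂ V']

/-- The homomorphism of representations from an induced representation that corresponds to an
equivariant map by Frobenius reciprocity. -/
def indLift (f : H →* G) (ρ : Representation ℂ H V) (σ : Representation ℂ G V') (φ : V →ₗ[ℂ] V')
    (hφ : ∀ h a, φ (ρ h a) = σ (f h) (φ a)) : Representation.IndV f ρ →ₗ[ℂ] V' :=
  Representation.Coinvariants.lift _
    (TensorProduct.lift <| (Finsupp.lift _ _ _ fun g => σ g⁻¹ ∘ₗ φ) ∘ₗ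
      (MonoidAlgebra.coeffLinearEquiv ℂ).toLinearMap)
    fun h => by
      ext g x
      simp only [LinearMap.coe_comp, Function.comp_apply, MonoidAlgebra.lsingle_apply]
      simp [Representation.ofMulAction_single, mul_inv_rev, hφ]

theorem indLift_mk (f : H →* G) (ρ : Representation ℂ H V) (σ : Representation ℂ G V')
    (φ : V →ₗ[ℂ] V') (hφ : ∀ h a, φ (ρ h a) = σ (f h) (φ a)) (g : G) (a : V) :
    indLift f ρ σ φ hφ (Representation.IndV.mk f ρ g a) = σ g⁻¹ (φ a) := by
  simp [indLift]

theorem indLift_ind (f : H →* G) (ρ : Representation ℂ H V) (σ : Representation ℂ G V')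
    (φ : V →ₗ[ℂ] V') (hφ : ∀ h a, φ (ρ h a) = σ (f h) (φ a)) (g : G)
    (m : Representation.IndV f ρ) :
    indLift f ρ σ φ hφ (Representation.ind f ρ g m) = σ g (indLift f ρ σ φ hφ m) := by
  suffices indLift f ρ σ φ hφ ∘ₗ Representation.ind f ρ g = σ g ∘ₗ indLift f ρ σ φ hφ from
    LinearMap.congr_fun this m
  refine Representation.IndV.hom_ext _ _ fun x => LinearMap.ext fun a => ?_
  change indLift f ρ σ φ hφ (Representation.ind f ρ g (Representation.IndV.mk f ρ x a)) =
    σ g (indLift f ρ σ φ hφ (Representation.IndV.mk f ρ x a))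
  rw [Representation.ind_mk, indLift_mk, indLift_mk,
    mul_inv_rev, inv_inv, map_mul, Module.End.mul_apply]

theorem indV_mk_mul (f : H →* G) (ρ : Representation ℂ H V) (h : H) (g : G) (a : V) :
    Representation.IndV.mk f ρ (f h * g) (ρ h a) = Representation.IndV.mk f ρ g a := by
  have := Representation.Coinvariants.mk_self_apply
    (Representation.tprod ((Representation.leftRegular ℂ G).comp f) ρ) h
    (TensorProduct.tmul ℂ (MonoidAlgebra.single g 1) a)
  simpa [Representation.ofMulAction_single] using this

end Induction

section ParabolicInduction

variable {S I : Set G} {L : G → ℤ} (hS : IsExchangeSystem S) (hL : IsPositiveWeight S L)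
  (hI : I ⊆ S)
include hS hL hI

/-- The elements of `G` whose parabolic part lies in a convex set form a convex set. -/
theorem isConvexFor_preimage {C : Set (Subgroup.closure I)}
    (hC : IsConvexFor (LeftLE (parabolicGens I) (parabolicWeight L I)) C) :
    IsConvexFor (LeftLE S L) (parabolicPart hS hI ⁻¹' C) := fun _ _ _ hx hz hxy hyz =>
  hC _ _ _ hx hz (leftLE_parabolicPart hS hL hI hxy) (leftLE_parabolicPart hS hL hI hyz)

omit hL in
theorem parabolicPart_coe (u : Subgroup.closure I) : parabolicPart hS hI (u : G) = u := by
  have := parabolicPart_mul hS hI ⟨1, one_mem_minReps⟩ u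
  rwa [one_mul] at this

/-- The embedding of group algebras `ℂ[W_I] → ℂ[W]` in coordinates with respect to the specialised
Kazhdan–Lusztig bases. -/
theorem specB_repr_coe (w u : Subgroup.closure I) :
    (specB hS hL).repr (MonoidAlgebra.single (w : G) 1 * specHecke (klBasis S L (u : G))) =
      ((specB (isExchangeSystem_parabolicGens hS hI)
        (isPositiveWeight_parabolicGens hS hI hL)).repr (MonoidAlgebra.single w 1 *
          specHecke (klBasis (parabolicGens I) (parabolicWeight L I) u))).mapDomain (↑) := by
  have hSI := isExchangeSystem_parabolicGens hS hI
  have hLI := isPositiveWeight_parabolicGens hS hI hL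
  let j : ℂ[Subgroup.closure I] →ₐ[ℂ] ℂ[G] :=
    MonoidAlgebra.mapDomainAlgHom ℂ ℂ (Subgroup.closure I).subtype
  have hj : ∀ h : Hecke (Subgroup.closure I),
      specHecke (parabolicIncl I h) = j (specHecke h) := by
    intro h
    induction h using Finsupp.induction_linear with
    | zero => simp only [map_zero, specHecke_zero]
    | add h h' ih ih' => rw [map_add, specHecke_add, ih, ih', specHecke_add, map_add]
    | single w a =>
      have e : (Finsupp.single w a : Hecke (Subgroup.closure I)) = a • stdBasis w := by simp
      rw [e, map_smul, specHecke_smul, specHecke_smul, map_smul, parabolicIncl_std, specHecke_std,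
        specHecke_std]
      simp [j]
  have hjb : ∀ v, j (specB hSI hLI v) = specB hS hL (v : G) := by
    intro v
    rw [specB_apply, specB_apply, ← hj, klBasis_coe hS hL hI]
  have hjs : j (MonoidAlgebra.single w 1) = MonoidAlgebra.single (w : G) 1 := by simp [j]
  rw [klBasis_coe hS hL hI, hj, ← hjs, ← map_mul]
  generalize MonoidAlgebra.single w 1 *
    specHecke (klBasis (parabolicGens I) (parabolicWeight L I) u) = a
  conv_lhs => rw [← (specB hSI hLI).linearCombination_repr a]
  rw [Finsupp.linearCombination_apply, Finsupp.sum, map_sum, map_sum, Finsupp.mapDomain,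
    Finsupp.sum]
  refine Finset.sum_congr rfl fun v _ => ?_
  rw [map_smul, map_smul, hjb, Module.Basis.repr_self, Finsupp.smul_single, smul_eq_mul, mul_one]

/-- The map `e_u ↦ e_u` from a representation of a parabolic subgroup. -/
def coeMap (C : Set (Subgroup.closure I)) :
    (C →₀ ℂ) →ₗ[ℂ] (parabolicPart hS hI ⁻¹' C →₀ ℂ) :=
  Finsupp.lmapDomain ℂ ℂ fun u => ⟨(u : Subgroup.closure I), by
    rw [Set.mem_preimage, parabolicPart_coe]; exact u.2⟩

omit hL in
theorem coeMap_restrictCoord (C : Set (Subgroup.closure I)) (f : Subgroup.closure I →₀ ℂ) :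
    coeMap hS hI C (restrictCoord C f) =
      restrictCoord (parabolicPart hS hI ⁻¹' C) (f.mapDomain (↑)) := by
  induction f using Finsupp.induction_linear with
  | zero => simp
  | add f g hf hg => rw [map_add, map_add, hf, hg, Finsupp.mapDomain_add, map_add]
  | single u a =>
    rw [Finsupp.mapDomain_single]
    have hiff : (u : G) ∈ parabolicPart hS hI ⁻¹' C ↔ u ∈ C := by
      rw [Set.mem_preimage, parabolicPart_coe]
    by_cases hu : u ∈ C
    · rw [restrictCoord_single_of_mem hu, restrictCoord_single_of_mem (hiff.2 hu)]
      simp [coeMap]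
    · rw [restrictCoord_single_of_notMem hu, restrictCoord_single_of_notMem (mt hiff.1 hu),
        map_zero]

omit hL in
theorem coeMap_single {C : Set (Subgroup.closure I)} {u : Subgroup.closure I} (hu : u ∈ C)
    (hu' : (u : G) ∈ parabolicPart hS hI ⁻¹' C) :
    coeMap hS hI C (Finsupp.single ⟨u, hu⟩ 1) = Finsupp.single ⟨u, hu'⟩ 1 := by
  simp [coeMap]

/-- The representation of `G` on the span of the `e_w` with parabolic part in `C`. -/
abbrev preimageRep {C : Set (Subgroup.closure I)}
    (hC : IsConvexFor (LeftLE (parabolicGens I) (parabolicWeight L I)) C) :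
    Representation ℂ G (parabolicPart hS hI ⁻¹' C →₀ ℂ) :=
  subquotient (isTriangularRep_klRep hS hL) (isConvexFor_preimage hS hL hI hC)

/-- The representation of the parabolic subgroup on the span of the `e_u`, `u ∈ C`. -/
abbrev parabolicRep {C : Set (Subgroup.closure I)}
    (hC : IsConvexFor (LeftLE (parabolicGens I) (parabolicWeight L I)) C) :
    Representation ℂ (Subgroup.closure I) (C →₀ ℂ) :=
  subquotient (isTriangularRep_klRep (isExchangeSystem_parabolicGens hS hI)
    (isPositiveWeight_parabolicGens hS hI hL)) hC

variable {C : Set (Subgroup.closure I)}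
  (hC : IsConvexFor (LeftLE (parabolicGens I) (parabolicWeight L I)) C)

theorem coeMap_parabolicRep (w : Subgroup.closure I) (f : C →₀ ℂ) :
    coeMap hS hI C (parabolicRep hS hL hI hC w f) =
      preimageRep hS hL hI hC w (coeMap hS hI C f) := by
  suffices coeMap hS hI C ∘ₗ parabolicRep hS hL hI hC w =
      preimageRep hS hL hI hC w ∘ₗ coeMap hS hI C from LinearMap.congr_fun this f
  refine Finsupp.lhom_ext' fun u => LinearMap.ext_ring ?_
  obtain ⟨u, hu⟩ := u
  have hu' : (u : G) ∈ parabolicPart hS hI ⁻¹' C := by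
    rwa [Set.mem_preimage, parabolicPart_coe]
  simp only [LinearMap.comp_apply, Finsupp.lsingle_apply]
  rw [coeMap_single hS hI hu hu', subquotient_single, subquotient_single, coeMap_restrictCoord,
    klRep_single, klRep_single, specB_repr_coe hS hL hI, len_parabolic hS hI,
    Finsupp.mapDomain_smul]

/-- By Frobenius reciprocity, the homomorphism from the induced representation. -/
def indToPreimage : Representation.IndV (Subgroup.closure I).subtype (parabolicRep hS hL hI hC)
    →ₗ[ℂ] (parabolicPart hS hI ⁻¹' C →₀ ℂ) :=
  indLift _ _ (preimageRep hS hL hI hC) (coeMap hS hI C) (coeMap_parabolicRep hS hL hI hC)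

theorem indToPreimage_surjective : Function.Surjective (indToPreimage hS hL hI hC) := by
  rw [← LinearMap.range_eq_top, eq_top_iff, ← Finsupp.basisSingleOne.span_eq, Submodule.span_le]
  rintro _ ⟨⟨w, hw⟩, rfl⟩
  obtain ⟨⟨x, u⟩, rfl⟩ := (cosetDecomp hS hI).surjective w
  have hu : u ∈ C := by simpa using hw
  rw [Finsupp.coe_basisSingleOne]
  have h1 := Submodule.mem_map_of_mem
    (f := restrictCoord (parabolicPart hS hI ⁻¹' C) ∘ₗ (specB hS hL).repr.toLinearMap)
    (specHecke_mem_span (klBasis_mem_span_relFamily hS hL hI x u))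
  have h2 : (restrictCoord (parabolicPart hS hI ⁻¹' C) ∘ₗ (specB hS hL).repr.toLinearMap)
      (specHecke (klBasis S L (x * u : G))) = Finsupp.single ⟨_, hw⟩ 1 := by
    rw [LinearMap.comp_apply, LinearEquiv.coe_coe, ← specB_apply hS hL, Module.Basis.repr_self]
    exact restrictCoord_single_of_mem hw 1
  rw [h2] at h1
  refine (Submodule.map_span_le _ _ _).2 ?_ h1
  rintro _ ⟨⟨y, v⟩, hv, rfl⟩
  have e : specHecke (relFamily S I L (y, v)) =
      MonoidAlgebra.single (y : G) 1 * specHecke (klBasis S L (v : G)) := by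
    rw [relFamily, relMap_apply, specHecke_heckeMul hS, specHecke_std, klBasis_coe hS hL hI]
  have hsign : (-1 : ℂ) ^ len S (y : G) * (-1) ^ len S (y : G) = 1 := by rw [← mul_pow]; simp
  have e2 : (specB hS hL).repr (MonoidAlgebra.single (y : G) 1 * specHecke (klBasis S L (v : G))) =
      (-1 : ℂ) ^ len S (y : G) • klRep hS hL y (Finsupp.single (v : G) 1) := by
    rw [klRep_single, smul_smul, hsign, one_smul]
  dsimp only
  rw [e, LinearMap.comp_apply, LinearEquiv.coe_coe, e2, map_smul]
  refine Submodule.smul_mem _ _ ?_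
  by_cases hvC : v ∈ C
  · have hv' : (v : G) ∈ parabolicPart hS hI ⁻¹' C := by rwa [Set.mem_preimage, parabolicPart_coe]
    refine ⟨Representation.IndV.mk _ _ (y : G)⁻¹ (Finsupp.single ⟨v, hvC⟩ 1), ?_⟩
    refine (indLift_mk _ _ _ _ _ _ _).trans ?_
    rw [inv_inv, coeMap_single hS hI hvC hv', subquotient_single]
  · -- Elements with parabolic part in `C` are not below `v`, by convexity of `C`.
    rw [restrictCoord_eq_zero (isTriangularRep_klRep hS hL)]
    · exact zero_mem _
    · intro z hz c hc hcz
      have hzv : z = v := by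
        by_contra h
        exact hz (Finsupp.single_eq_of_ne h)
      have h3 := leftLE_parabolicPart hS hL hI hcz
      rw [hzv, parabolicPart_coe] at h3
      exact hvC (hC _ _ _ hc hu h3 hv)

/-- The map sending `e_{xu}` to `x ⊗ e_u`. -/
def preimageToInd : (parabolicPart hS hI ⁻¹' C →₀ ℂ) →ₗ[ℂ]
    Representation.IndV (Subgroup.closure I).subtype (parabolicRep hS hL hI hC) :=
  Finsupp.linearCombination ℂ fun w => Representation.IndV.mk (Subgroup.closure I).subtype
    (parabolicRep hS hL hI hC) (((cosetDecomp hS hI).symm w).1 : G)⁻¹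
    (Finsupp.single ⟨parabolicPart hS hI w, w.2⟩ 1)

theorem preimageToInd_surjective : Function.Surjective (preimageToInd hS hL hI hC) := by
  have h1 : ∀ (x : minReps S I) (a : C →₀ ℂ), Representation.IndV.mk (Subgroup.closure I).subtype
      (parabolicRep hS hL hI hC) (x : G)⁻¹ a ∈ LinearMap.range (preimageToInd hS hL hI hC) := by
    intro x a
    induction a using Finsupp.induction_linear with
    | zero => rw [map_zero]; exact zero_mem _
    | add a b ha hb => rw [map_add]; exact add_mem ha hb
    | single u c =>
      obtain ⟨u, hu⟩ := u
      refine ⟨Finsupp.single ⟨cosetDecomp hS hI (x, u), by simpa using hu⟩ c, ?_⟩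
      rw [preimageToInd, Finsupp.linearCombination_single, ← map_smul, Finsupp.smul_single,
        smul_eq_mul, mul_one]
      simp only [Equiv.symm_apply_apply]
      congr 2
      exact Subtype.ext (by simp)
  rw [← LinearMap.range_eq_top, ← Submodule.ker_mkQ (LinearMap.range _), LinearMap.ker_eq_top]
  refine Representation.IndV.hom_ext _ _ fun g => LinearMap.ext fun a => ?_
  refine (Submodule.Quotient.mk_eq_zero _).2 ?_
  change Representation.IndV.mk _ _ g a ∈ _
  obtain ⟨⟨x, u⟩, hxu⟩ := (cosetDecomp hS hI).surjective g⁻¹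
  have h2 := indV_mk_mul (Subgroup.closure I).subtype (parabolicRep hS hL hI hC) u g a
  have h3 : (Subgroup.closure I).subtype u * g = (x : G)⁻¹ := by
    rw [← inv_inv g, ← hxu]
    simp
  rw [← h2, h3]
  exact h1 x _

/-- The representation induced from the span of the `e_u`, `u ∈ C`, is the span of the `e_w` whose
parabolic part is in `C`. -/
theorem nonempty_ind_equiv_preimageRep [Finite G] :
    Nonempty ((Representation.ind (Subgroup.closure I).subtype (parabolicRep hS hL hI hC)).Equiv
      (preimageRep hS hL hI hC)) := by
  refine nonempty_equiv_of_bijective (indToPreimage hS hL hI hC)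
    ⟨?_, indToPreimage_surjective hS hL hI hC⟩ (fun g f => indLift_ind _ _ _ _ _ g f)
  -- The composite with `e_{xu} ↦ x ⊗ e_u` is a surjective endomorphism, hence injective.
  have h1 : Function.Injective (indToPreimage hS hL hI hC ∘ₗ preimageToInd hS hL hI hC) :=
    LinearMap.injective_iff_surjective.2 ((indToPreimage_surjective hS hL hI hC).comp
      (preimageToInd_surjective hS hL hI hC))
  intro a b hab
  obtain ⟨a, rfl⟩ := preimageToInd_surjective hS hL hI hC a
  obtain ⟨b, rfl⟩ := preimageToInd_surjective hS hL hI hC b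
  rw [h1 hab]

theorem leftCell_subset_preimage {Γ' : Set (Subgroup.closure I)}
    (hΓ' : IsLeftCell (parabolicGens I) (parabolicWeight L I) Γ') {y : G}
    (hy : parabolicPart hS hI y ∈ Γ') :
    {z | LeftLE S L z y ∧ LeftLE S L y z} ⊆ parabolicPart hS hI ⁻¹' Γ' := by
  obtain ⟨w, rfl⟩ := hΓ'
  rintro z ⟨h1, h2⟩
  have h3 := leftLE_parabolicPart hS hL hI h1
  have h4 := leftLE_parabolicPart hS hL hI h2
  exact ⟨leftLE_trans h3 hy.1, leftLE_trans hy.2 h4⟩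

end ParabolicInduction

end KLCells

end

theorem mainTheorem12 {B W : Type*} [Group W] [Finite W] {M : CoxeterMatrix B}
    (cs : CoxeterSystem M W) (L : W → ℤ)
    (hL : KLCells.IsPositiveWeight (Set.range cs.simple) L)
    (I : Set W) (hI : I ⊆ Set.range cs.simple)
    (Γ' : Set (Subgroup.closure I))
    (hΓ' : KLCells.IsLeftCell {s : Subgroup.closure I | (s : W) ∈ I} (fun w => L w) Γ') :
    (∃! ρ' : Representation ℂ (Subgroup.closure I) (Γ' →₀ ℂ),
      KLCells.IsLeftCellRep {s : Subgroup.closure I | (s : W) ∈ I} (fun w => L w) Γ' ρ') ∧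
    ∀ ρ' : Representation ℂ (Subgroup.closure I) (Γ' →₀ ℂ),
      KLCells.IsLeftCellRep {s : Subgroup.closure I | (s : W) ∈ I} (fun w => L w) Γ' ρ' →
      ∃ (r : ℕ) (Γ : Fin r → Set W) (ρ : ∀ i, Representation ℂ W (Γ i →₀ ℂ)),
        Function.Injective Γ ∧
        (∀ i, KLCells.IsLeftCell (Set.range cs.simple) L (Γ i)) ∧
        (∀ i, KLCells.IsLeftCellRep (Set.range cs.simple) L (Γ i) (ρ i)) ∧
        Nonempty ((Representation.ind (Subgroup.closure I).subtype ρ').Equiv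
          (Representation.directSum ρ)) := by
  have hS := KLCells.isExchangeSystem_range_simple cs
  have hSI := KLCells.isExchangeSystem_parabolicGens hS hI
  have hLI := KLCells.isPositiveWeight_parabolicGens hS hI hL
  have hC := KLCells.isConvexFor_leftCell hΓ'
  have hrep := KLCells.isLeftCellRep_subquotient hSI hLI hC
  refine ⟨⟨_, hrep, fun ρ hρ => KLCells.isLeftCellRep_unique hSI hLI hρ hrep⟩, fun ρ' hρ' => ?_⟩
  obtain rfl := KLCells.isLeftCellRep_unique hSI hLI hρ' hrep
  let cells : Set (Set W) := {Γ | KLCells.IsLeftCell (Set.range cs.simple) L Γ ∧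
    Γ ⊆ KLCells.parabolicPart hS hI ⁻¹' Γ'}
  obtain ⟨r, ⟨e⟩⟩ := Finite.exists_equiv_fin cells
  let Γ : Fin r → Set W := fun i => e.symm i
  have hinj : Function.Injective Γ := Subtype.val_injective.comp e.symm.injective
  have hcell : ∀ i, KLCells.IsLeftCell (Set.range cs.simple) L (Γ i) := fun i => (e.symm i).2.1
  have hΓ := fun i => KLCells.isConvexFor_leftCell (hcell i)
  have hcov : ∀ y ∈ KLCells.parabolicPart hS hI ⁻¹' Γ', ∃ i, y ∈ Γ i := by
    intro y hy
    refine ⟨e ⟨_, ⟨y, rfl⟩, KLCells.leftCell_subset_preimage hS hL hI hΓ' hy⟩, ?_⟩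
    simp only [Γ, Equiv.symm_apply_apply]
    exact ⟨KLCells.leftLE_refl y, KLCells.leftLE_refl y⟩
  obtain ⟨φ⟩ := KLCells.nonempty_ind_equiv_preimageRep hS hL hI hC
  obtain ⟨ψ⟩ := KLCells.nonempty_equiv_directSum (KLCells.isTriangularRep_klRep hS hL)
    KLCells.leftLE_refl (fun _ _ _ => KLCells.leftLE_trans)
    (KLCells.isConvexFor_preimage hS hL hI hC) Γ hinj hcell hΓ (fun i => (e.symm i).2.2) hcov
  exact ⟨r, Γ, _, hinj, hcell, fun i => KLCells.isLeftCellRep_subquotient hS hL (hΓ i),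
    ⟨φ.trans ψ⟩⟩
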